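/- Throughout, groups are finite, $\pi$ is a set of primes and $\pi'$ is its complement in the set of all primes. A natural number is a $\pi$-number if all its prime divisors lie in $\pi$; a $\pi$-subgroup is a subgroup whose order is a $\pi$-number; a Hall $\pi$-subgroup of a group $G$ is a $\pi$-subgroup $H$ of $G$ such that $|G:H|$ is a $\pi'$-number. For subgroups $A,B,X$ of $G$, one says that $A$ is $X$-permutable with $B$ if $AB^x=B^xA$ for some $x\in X$, where $B^x=x^{-1}Bx$. Theorem 5.3. Let $X$ be a normal subgroup of $G$ such that $X$ has a nilpotent Hall $\pi$-subgroup. Suppose that $G$ has a series of subgroups $$1=H_0<H_1\le\cdots\le H_{t-1}\le H_t=G\qquad(t\ge 1)$$ such that, for each $i=0,\dots,t-1$, at most one prime in $\pi$ divides the index $|H_{i+1}:H_i|$. Suppose also that $G$ has a subgroup $T$ such that $H_1T=G$ and $|G:T|$ is a $\pi'$-number. If, for every $i=1,\dots,t$, the subgroup $H_i$ is $X$-permutable with every cyclic subgroup of $T$ of prime power order, then $G$ is a $D^S_\pi$-group, that is: $G$ has a soluble Hall $\pi$-subgroup, any two Hall $\pi$-subgroups of $G$ are conjugate in $G$, and every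 $\pi$-subgroup of $G$ is contained in some Hall $\pi$-subgroup of $G$. -/

import Mathlib

open scoped Pointwise

namespace PiHall

/-- `n` is a `π`-number: it is coprime to every prime outside `π`. -/
def IsPiNumber (π : Set ℕ) (n : ℕ) : Prop :=
  ∀ p : ℕ, p.Prime → p ∉ π → Nat.Coprime n p

/-- At most one prime in `π` divides `n`. -/
def AtMostOnePrime (π : Set ℕ) (n : ℕ) : Prop :=
  ∀ p q : ℕ, p.Prime → q.Prime → p ∈ π → q ∈ π → p ∣ n → q ∣ n → p = q

/-- `H` is a `π`-subgroup of `G` (used for finite `G`). -/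
def IsPiSubgroup (π : Set ℕ) {G : Type*} [Group G] (H : Subgroup G) : Prop :=
  IsPiNumber π (Nat.card H)

/-- `H` is a Hall `π`-subgroup of `G` (used for finite `G`):
`|H|` is a `π`-number and `|G : H|` is a `π'`-number. -/
def IsHall (π : Set ℕ) {G : Type*} [Group G] (H : Subgroup G) : Prop :=
  IsPiSubgroup π H ∧ IsPiNumber πᶜ H.index

/-- `AB = BA` as sets of products. -/
def Permutes {G : Type*} [Group G] (A B : Subgroup G) : Prop :=
  (A : Set G) * (B : Set G) = (B : Set G) * (A : Set G)

/-- The conjugate `B ^ x = x⁻¹ B x`. -/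
def conj {G : Type*} [Group G] (B : Subgroup G) (x : G) : Subgroup G :=
  MulAut.conj x⁻¹ • B

/-- `A` is `X`-permutable with `B`: `A B ^ x = B ^ x A` for some `x ∈ X`. -/
def XPermutes {G : Type*} [Group G] (X : Set G) (A B : Subgroup G) : Prop :=
  ∃ x ∈ X, Permutes A (conj B x)

/-- `E_π`-group: there is a Hall `π`-subgroup. -/
def IsE (π : Set ℕ) (G : Type*) [Group G] : Prop :=
  ∃ H : Subgroup G, IsHall π H

/-- `E^N_π`-group: there is a nilpotent Hall `π`-subgroup. -/
def IsEN (π : Set ℕ) (G : Type*) [Group G] : Prop :=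
  ∃ H : Subgroup G, IsHall π H ∧ Group.IsNilpotent H

/-- `E^S_π`-group: there is a soluble Hall `π`-subgroup. -/
def IsES (π : Set ℕ) (G : Type*) [Group G] : Prop :=
  ∃ H : Subgroup G, IsHall π H ∧ Group.IsSolvable H

/-- `C_π`-group: an `E_π`-group in which any two Hall `π`-subgroups are conjugate. -/
def IsC (π : Set ℕ) (G : Type*) [Group G] : Prop :=
  IsE π G ∧ ∀ H K : Subgroup G, IsHall π H → IsHall π K → ∃ x : G, K = conj H x

/-- `C^S_π`-group: a `C_π`-group with a soluble Hall `π`-subgroup. -/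
def IsCS (π : Set ℕ) (G : Type*) [Group G] : Prop :=
  IsES π G ∧ IsC π G

/-- `D^S_π`-group: a `C^S_π`-group in which every `π`-subgroup lies in a Hall `π`-subgroup. -/
def IsDS (π : Set ℕ) (G : Type*) [Group G] : Prop :=
  IsCS π G ∧ ∀ U : Subgroup G, IsPiSubgroup π U → ∃ H : Subgroup G, IsHall π H ∧ U ≤ H

end PiHall

namespace PiHall

/-! ### Arithmetic of `π`-numbers. -/

section Arithmetic

/-! The hypotheses yield a normal series `G = M_0 ≥ ... ≥ M_t = X` whose factor orders are each
divisible by at most one prime of `π`. Let `g` be a `q`-element with `q ∈ π`. As `q` does not divide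
`|G : T|`, some conjugate of `g` lies in `T`, and `H_1 T = G` lets the conjugator be taken in `H_1`;
hence every `H_i X` permutes with `⟨g⟩` (`mulSwaps_sup_zpowers`). If moreover `g ∈ H_{i+1} X` and
`q` does not divide `|H_{i+1} : H_i|`, comparing indices forces `g ∈ H_i X`
(`MulSwaps.mem_of_not_dvd`). So let `M_{j+1}` be generated by `X` and the `q`-elements of `M_j` for
those `q ∈ π` not dividing `|H_{t-j} : H_{t-j-1}|`. Then `M_j ≤ H_{t-j} X`, so the series ends at
`X`, and `M_{j+1}` contains a Sylow `q`-subgroup of `M_j` for each such `q`.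

Every factor, and `X` itself, has a nilpotent Hall `π`-subgroup, so P. Hall's extension theorem
(`HasDominantSolubleHall.of_surjective`) climbs the series from the trivial group to `G`. Existence
in that theorem is Schur–Zassenhaus after a Frattini argument (`exists_isHall_of_normal`). Dominance
is `IsNilpotentBySoluble.exists_conj`: for a maximal `π`-subgroup `M`, one passes to the normalizer
of a nontrivial `O_q(M)`, or factors it out when it is normal.

Both rest on Wielandt's theorem (`IsHallIn.exists_conj_of_primaryCommute`). There a `π`-subgroup is
first shown nilpotent by fusion and transfer, as in Frobenius' criterion, and then split as a
`p`-part times a complement treated by induction. -/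

lemma isPiNumber_iff {π : Set ℕ} {n : ℕ} :
    IsPiNumber π n ↔ ∀ p : ℕ, p.Prime → p ∣ n → p ∈ π := by
  refine forall₂_congr fun p hp => ?_
  rw [Nat.coprime_comm, hp.coprime_iff_not_dvd]
  tauto

lemma isPiNumber_compl_iff {π : Set ℕ} {n : ℕ} :
    IsPiNumber πᶜ n ↔ ∀ p : ℕ, p.Prime → p ∈ π → ¬ p ∣ n := by
  rw [isPiNumber_iff]
  refine forall₂_congr fun p _ => ?_
  simp only [Set.mem_compl_iff]
  tauto

lemma IsPiNumber.of_dvd {π : Set ℕ} {m n : ℕ} (h : IsPiNumber π n) (hmn : m ∣ n) :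
    IsPiNumber π m :=
  isPiNumber_iff.2 fun p hp hpm => isPiNumber_iff.1 h p hp (hpm.trans hmn)

lemma IsPiNumber.mul {π : Set ℕ} {m n : ℕ} (hm : IsPiNumber π m) (hn : IsPiNumber π n) :
    IsPiNumber π (m * n) :=
  fun p hp hpπ => Nat.Coprime.mul_left (hm p hp hpπ) (hn p hp hpπ)

lemma IsPiNumber.coprime {π : Set ℕ} {m n : ℕ} (hm : IsPiNumber π m) (hn : IsPiNumber πᶜ n) :
    m.Coprime n :=
  Nat.coprime_of_dvd fun p hp hpm hpn =>
    isPiNumber_compl_iff.1 hn p hp (isPiNumber_iff.1 hm p hp hpm) hpn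

lemma eq_one_of_forall_prime_not_dvd {n : ℕ} (h : ∀ p : ℕ, p.Prime → ¬ p ∣ n) : n = 1 := by
  by_contra hn
  obtain ⟨p, hp, hpn⟩ := Nat.exists_prime_and_dvd hn
  exact h p hp hpn

end Arithmetic

/-! ### Conjugates of subgroups. -/

section Conjugation

variable {G : Type*} [Group G]

lemma mem_conj_smul {S : Subgroup G} {g x : G} : x ∈ MulAut.conj g • S ↔ g⁻¹ * x * g ∈ S := by
  rw [Subgroup.mem_pointwise_smul_iff_inv_smul_mem, ← map_inv]
  simp [MulAut.smul_def]

lemma conj_mem_conj_smul {S : Subgroup G} {g x : G} (hx : x ∈ S) :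
    g * x * g⁻¹ ∈ MulAut.conj g • S := by
  rw [mem_conj_smul]
  convert hx using 1
  group

lemma card_conj_smul (g : G) (S : Subgroup G) : Nat.card ↥(MulAut.conj g • S) = Nat.card S :=
  Nat.card_congr (Subgroup.equivSMul (MulAut.conj g) S).symm.toEquiv

lemma conj_smul_mul (g h : G) (S : Subgroup G) :
    MulAut.conj (g * h) • S = MulAut.conj g • MulAut.conj h • S := by
  rw [map_mul, mul_smul]

lemma conj_smul_le_iff {g : G} {S T : Subgroup G} :
    MulAut.conj g • S ≤ T ↔ S ≤ MulAut.conj g⁻¹ • T := by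
  rw [Subgroup.pointwise_smul_subset_iff, map_inv]

lemma conj_smul_mono (g : G) {S T : Subgroup G} (h : S ≤ T) :
    MulAut.conj g • S ≤ MulAut.conj g • T :=
  Subgroup.pointwise_smul_le_pointwise_smul_iff.2 h

lemma conj_smul_le_self {N S : Subgroup G} (hS : S ≤ N) {g : G} (hg : g ∈ N) :
    MulAut.conj g • S ≤ N :=
  Subgroup.conj_smul_le_of_le hS ⟨g, hg⟩

lemma mem_normalizer_of_conj_smul_le [Finite G] {S : Subgroup G} {g : G}
    (h : MulAut.conj g • S ≤ S) : g ∈ Subgroup.normalizer (S : Set G) := by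
  rw [Subgroup.mem_normalizer_iff_map_conj_eq]
  exact Subgroup.eq_of_le_of_card_ge h (card_conj_smul g S).ge

lemma conj_smul_of_mem_normalizer {S : Subgroup G} {g : G}
    (h : g ∈ Subgroup.normalizer (S : Set G)) : MulAut.conj g • S = S :=
  Subgroup.mem_normalizer_iff_map_conj_eq.1 h

lemma index_conj_smul (g : G) (S : Subgroup G) : (MulAut.conj g • S).index = S.index := by
  simpa using Subgroup.relIndex_pointwise_smul (MulAut.conj g) S ⊤

end Conjugation

/-! ### Indices in products of subgroups. -/

section Index

variable {G : Type*} [Group G]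

/-- If `M = A B`, then `|M : A| = |B : A ∩ B|`. -/
lemma relIndex_eq_of_factor {A B M : Subgroup G} (hB : B ≤ M)
    (h : ∀ m ∈ M, ∃ a ∈ A, ∃ b ∈ B, m = a * b) : A.relIndex M = A.relIndex B := by
  refine (Nat.card_congr (Equiv.ofBijective (Subgroup.quotientSubgroupOfEmbeddingOfLE A hB)
    ⟨(Subgroup.quotientSubgroupOfEmbeddingOfLE A hB).injective, fun q => ?_⟩)).symm
  induction q using QuotientGroup.induction_on with
  | H m =>
    -- Quotients are by left cosets, so it is `m⁻¹ = a b` that is factored: then `m A = b⁻¹ A`.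
    obtain ⟨a, ha, b, hb, hab⟩ := h _ (inv_mem m.2)
    refine ⟨QuotientGroup.mk ⟨b⁻¹, inv_mem hb⟩, ?_⟩
    rw [Subgroup.quotientSubgroupOfEmbeddingOfLE_apply_mk]
    refine QuotientGroup.eq.2 ?_
    rw [Subgroup.mem_subgroupOf]
    have : (m : G) = b⁻¹ * a⁻¹ := by rw [← mul_inv_rev, ← hab, inv_inv]
    simpa [this] using ha

lemma exists_mul_of_mem_sup {A B : Subgroup G} (hAB : A ≤ Subgroup.normalizer (B : Set G)) {m : G}
    (hm : m ∈ A ⊔ B) : ∃ a ∈ A, ∃ b ∈ B, m = a * b := by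
  rw [← SetLike.mem_coe, Subgroup.coe_mul_of_left_le_normalizer_right _ _ hAB] at hm
  obtain ⟨a, ha, b, hb, rfl⟩ := hm
  exact ⟨a, ha, b, hb, rfl⟩

lemma exists_mul_of_mem_sup_right {A B : Subgroup G} (hAB : A ≤ Subgroup.normalizer (B : Set G))
    {m : G} (hm : m ∈ A ⊔ B) : ∃ b ∈ B, ∃ a ∈ A, m = b * a := by
  obtain ⟨a, ha, b, hb, h⟩ := exists_mul_of_mem_sup hAB (inv_mem hm)
  exact ⟨b⁻¹, inv_mem hb, a⁻¹, inv_mem ha, by rw [← mul_inv_rev, ← h, inv_inv]⟩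

lemma card_mul_relIndex {A M : Subgroup G} (h : A ≤ M) :
    Nat.card A * A.relIndex M = Nat.card M := by
  have := Subgroup.relIndex_mul_relIndex ⊥ A M bot_le h
  simpa using this

lemma relIndex_sup_dvd_card {A B : Subgroup G} (hAB : A ≤ Subgroup.normalizer (B : Set G)) :
    B.relIndex (A ⊔ B) ∣ Nat.card A := by
  rw [relIndex_eq_of_factor (B := A) le_sup_left
    fun m hm => exists_mul_of_mem_sup_right hAB hm]
  exact Subgroup.relIndex_dvd_card _ _

lemma card_sup_dvd {A B : Subgroup G} (hAB : A ≤ Subgroup.normalizer (B : Set G)) :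
    Nat.card ↥(A ⊔ B) ∣ Nat.card A * Nat.card B := by
  rw [← card_mul_relIndex (le_sup_right : B ≤ A ⊔ B), mul_comm]
  exact Nat.mul_dvd_mul_right (relIndex_sup_dvd_card hAB) _

lemma relIndex_dvd_of_le_of_le {A B M : Subgroup G} (h : A ≤ B) (hB : B ≤ M) :
    A.relIndex B ∣ A.relIndex M :=
  ⟨_, (Subgroup.relIndex_mul_relIndex A B M h hB).symm⟩

end Index

/-! ### Elements of prime power order. -/

section PrimaryElements

variable {G : Type*} [Group G]

/-- `x` is a `p`-element. -/
def IsPrimaryElt (p : ℕ) (x : G) : Prop := ∃ k : ℕ, x ^ p ^ k = 1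

lemma IsPrimaryElt.of_mem {p : ℕ} {P : Subgroup G} (hP : IsPGroup p P) {x : G} (hx : x ∈ P) :
    IsPrimaryElt p x := by
  obtain ⟨k, hk⟩ := hP ⟨x, hx⟩
  exact ⟨k, by simpa [Subtype.ext_iff] using hk⟩

lemma IsPrimaryElt.isPGroup_zpowers {p : ℕ} {x : G} (hx : IsPrimaryElt p x) :
    IsPGroup p (Subgroup.zpowers x) := by
  obtain ⟨k, hk⟩ := hx
  rintro ⟨y, m, rfl⟩
  refine ⟨k, ?_⟩
  ext
  simp only [SubmonoidClass.coe_pow, OneMemClass.coe_one]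
  rw [← zpow_natCast, ← zpow_mul, mul_comm, zpow_mul, zpow_natCast, hk, one_zpow]

lemma IsPrimaryElt.map {p : ℕ} {x : G} (hx : IsPrimaryElt p x) {H : Type*} [Group H]
    (f : G →* H) : IsPrimaryElt p (f x) := by
  obtain ⟨k, hk⟩ := hx
  exact ⟨k, by rw [← map_pow, hk, map_one]⟩

lemma IsPrimaryElt.conj {p : ℕ} {x : G} (hx : IsPrimaryElt p x) (g : G) :
    IsPrimaryElt p (g * x * g⁻¹) :=
  hx.map (MulAut.conj g).toMonoidHom

lemma IsPrimaryElt.eq_one {p q : ℕ} (hp : p.Prime) (hq : q.Prime) (hpq : p ≠ q) {x : G}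
    (h : IsPrimaryElt p x) (h' : IsPrimaryElt q x) : x = 1 := by
  obtain ⟨k, hk⟩ := h
  obtain ⟨l, hl⟩ := h'
  have hc : Nat.Coprime (p ^ k) (q ^ l) :=
    Nat.Coprime.pow _ _ ((Nat.coprime_primes hp hq).2 hpq)
  rw [← orderOf_eq_one_iff, ← Nat.dvd_one, ← hc]
  exact Nat.dvd_gcd (orderOf_dvd_of_pow_eq_one hk) (orderOf_dvd_of_pow_eq_one hl)

lemma IsPGroup.conj_smul {p : ℕ} {P : Subgroup G} (hP : IsPGroup p P) (g : G) :
    IsPGroup p ↥(MulAut.conj g • P) :=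
  hP.of_equiv (Subgroup.equivSMul (MulAut.conj g) P)

lemma IsPGroup.eq_of_prime_dvd_card [Finite G] {p q : ℕ} (hp : p.Prime) (hq : q.Prime)
    {P : Subgroup G} (hP : IsPGroup p P) (h : q ∣ Nat.card P) : q = p := by
  have := Fact.mk hp
  obtain ⟨n, hn⟩ := IsPGroup.iff_card.1 hP
  rw [hn] at h
  exact (Nat.prime_dvd_prime_iff_eq hq hp).1 (hq.dvd_of_dvd_pow h)

lemma IsPGroup.isPiSubgroup [Finite G] {π : Set ℕ} {p : ℕ} (hp : p.Prime) (hpπ : p ∈ π)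
    {P : Subgroup G} (hP : IsPGroup p P) : IsPiSubgroup π P :=
  isPiNumber_iff.2 fun _ hq hqP => IsPGroup.eq_of_prime_dvd_card hp hq hP hqP ▸ hpπ

lemma isPGroup_of_forall_prime [Finite G] {p : ℕ} {P : Subgroup G}
    (h : ∀ q : ℕ, q.Prime → q ∣ Nat.card P → q = p) : IsPGroup p P := by
  refine IsPGroup.of_card (n := (Nat.card P).primeFactorsList.length) ?_
  exact Nat.eq_prime_pow_of_unique_prime_dvd Nat.card_pos.ne' (fun {q} hq hqP => h q hq hqP)

end PrimaryElements

/-! ### Sylow theory relative to a subgroup. -/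

section Sylow

variable {G : Type*} [Group G]

/-- `P` is a Sylow `p`-subgroup of the subgroup `K`. -/
structure IsSylowIn (p : ℕ) (P K : Subgroup G) : Prop where
  le : P ≤ K
  isPGroup : IsPGroup p P
  not_dvd : ¬ p ∣ P.relIndex K

variable {p : ℕ}

lemma IsSylowIn.mono {P K L : Subgroup G} (hP : IsSylowIn p P K) (hPL : P ≤ L) (hLK : L ≤ K) :
    IsSylowIn p P L :=
  ⟨hPL, hP.isPGroup, fun h => hP.not_dvd (h.trans (relIndex_dvd_of_le_of_le hPL hLK))⟩

lemma IsSylowIn.trans (hp : p.Prime) {P K L : Subgroup G} (hP : IsSylowIn p P K) (hKL : K ≤ L)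
    (h : ¬ p ∣ K.relIndex L) : IsSylowIn p P L :=
  ⟨hP.le.trans hKL, hP.isPGroup, by
    rw [← Subgroup.relIndex_mul_relIndex P K L hP.le hKL, hp.dvd_mul]
    exact not_or.2 ⟨hP.not_dvd, h⟩⟩

/-- A subgroup containing a Sylow `p`-subgroup of `S` for every prime `p` contains `S`. -/
lemma le_of_isSylowIn {K S : Subgroup G}
    (h : ∀ p : ℕ, p.Prime → ∃ P, IsSylowIn p P S ∧ P ≤ K) : S ≤ K := by
  rw [← Subgroup.relIndex_eq_one]
  refine eq_one_of_forall_prime_not_dvd fun p hp hpd => ?_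
  obtain ⟨P, hP, hPK⟩ := h p hp
  exact hP.not_dvd (hpd.trans (Subgroup.relIndex_dvd_of_le_left _ hPK))

variable [Finite G]

lemma exists_isSylowIn_ge (hp : p.Prime) {Q K : Subgroup G} (hQK : Q ≤ K) (hQ : IsPGroup p Q) :
    ∃ P, IsSylowIn p P K ∧ Q ≤ P := by
  have := Fact.mk hp
  obtain ⟨P, hP⟩ := (hQ.comap_subtype (K := K)).exists_le_sylow
  refine ⟨(P : Subgroup K).map K.subtype, ⟨Subgroup.map_subtype_le _, P.2.map _, ?_⟩, ?_⟩
  · rw [Subgroup.relIndex, Subgroup.subgroupOf,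
      Subgroup.comap_map_eq_self_of_injective K.subtype_injective]
    exact P.not_dvd_index
  · have := Subgroup.map_mono (f := K.subtype) hP
    rwa [← Subgroup.subgroupOf, Subgroup.map_subgroupOf_eq_of_le hQK] at this

lemma exists_isSylowIn (hp : p.Prime) (K : Subgroup G) : ∃ P, IsSylowIn p P K :=
  (exists_isSylowIn_ge hp bot_le IsPGroup.of_bot).imp fun _ h => h.1

lemma IsSylowIn.exists_conj (hp : p.Prime) {P Q K : Subgroup G} (hP : IsSylowIn p P K)
    (hQK : Q ≤ K) (hQ : IsPGroup p Q) : ∃ k ∈ K, Q ≤ MulAut.conj k • P := by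
  have := Fact.mk hp
  let P' : Sylow p K := (hP.isPGroup.comap_subtype (K := K)).toSylow hP.not_dvd
  obtain ⟨R, hR⟩ := (hQ.comap_subtype (K := K)).exists_le_sylow
  obtain ⟨k, rfl⟩ := MulAction.exists_smul_eq K P' R
  refine ⟨k, k.2, fun x hx => ?_⟩
  have hx' : (⟨x, hQK hx⟩ : K) ∈ k • P' := hR (Subgroup.mem_comap.2 hx)
  have h2 : (⟨x, hQK hx⟩ : K) ∈ MulAut.conj k • (P' : Subgroup K) := hx'
  rw [mem_conj_smul] at h2
  rw [mem_conj_smul]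
  exact h2

lemma IsSylowIn.of_card_eq (hp : p.Prime) {P Q K : Subgroup G} (hP : IsSylowIn p P K)
    (hQK : Q ≤ K) (h : Nat.card Q = Nat.card P) : IsSylowIn p Q K := by
  have := Fact.mk hp
  have h1 := card_mul_relIndex hP.le
  have h2 := card_mul_relIndex hQK
  rw [h, ← h1] at h2
  have h3 := Nat.eq_of_mul_eq_mul_left Nat.card_pos h2
  refine ⟨hQK, ?_, h3 ▸ hP.not_dvd⟩
  rw [IsPGroup.iff_card, h]
  exact IsPGroup.iff_card.1 hP.isPGroup

lemma IsSylowIn.eq_of_le (hp : p.Prime) {P Q K : Subgroup G} (hP : IsSylowIn p P K) (hPQ : P ≤ Q)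
    (hQK : Q ≤ K) (hQ : IsPGroup p Q) : P = Q := by
  obtain ⟨k, -, hk⟩ := hP.exists_conj hp hQK hQ
  refine Subgroup.eq_of_le_of_card_ge hPQ ?_
  rw [← card_conj_smul k P]
  exact Subgroup.card_le_of_le hk

end Sylow

/-! ### Nilpotency as commutation of elements of coprime prime power orders. -/

section Nilpotent

variable {G : Type*} [Group G]

/-- Elements of coprime prime power orders in `S` commute; for finite groups, this says that `S` is
nilpotent. -/
def PrimaryCommute (S : Subgroup G) : Prop :=
  ∀ p q : ℕ, p.Prime → q.Prime → p ≠ q → ∀ x ∈ S, ∀ y ∈ S,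
    IsPrimaryElt p x → IsPrimaryElt q y → Commute x y

lemma PrimaryCommute.mono {S T : Subgroup G} (hT : PrimaryCommute T) (h : S ≤ T) :
    PrimaryCommute S :=
  fun p q hp hq hpq x hx y hy => hT p q hp hq hpq x (h hx) y (h hy)

lemma PrimaryCommute.map {S : Subgroup G} (hS : PrimaryCommute S) {H : Type*} [Group H]
    (f : G →* H) (hf : Function.Injective f) : PrimaryCommute (S.map f) := by
  rintro p q hp hq hpq _ ⟨x, hx, rfl⟩ _ ⟨y, hy, rfl⟩ ⟨k, hk⟩ ⟨l, hl⟩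
  refine (hS p q hp hq hpq x hx y hy ⟨k, hf ?_⟩ ⟨l, hf ?_⟩).map f
  · rw [map_pow, hk, map_one]
  · rw [map_pow, hl, map_one]

lemma PrimaryCommute.comap {H : Type*} [Group H] {S : Subgroup H} (hS : PrimaryCommute S)
    (f : G →* H) (hf : Function.Injective f) : PrimaryCommute (S.comap f) := by
  intro p q hp hq hpq x hx y hy hpx hqy
  have := hS p q hp hq hpq (f x) hx (f y) hy (hpx.map f) (hqy.map f)
  exact hf (by rw [map_mul, map_mul, this.eq])

lemma PrimaryCommute.conj_smul {S : Subgroup G} (hS : PrimaryCommute S) (g : G) :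
    PrimaryCommute (MulAut.conj g • S) :=
  hS.map (MulAut.conj g).toMonoidHom (MulAut.conj g).injective

variable [Finite G]

/-- A `p`-subgroup and a subgroup of order prime to `p` in a nilpotent group commute. -/
lemma PrimaryCommute.le_centralizer {p : ℕ} (hp : p.Prime) {S P L : Subgroup G}
    (hS : PrimaryCommute S) (hPS : P ≤ S) (hP : IsPGroup p P) (hLS : L ≤ S)
    (hL : ¬ p ∣ Nat.card L) : L ≤ Subgroup.centralizer (P : Set G) := by
  refine le_of_isSylowIn fun q hq => ?_
  obtain ⟨Q, hQ⟩ := exists_isSylowIn hq L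
  refine ⟨Q, hQ, fun y hy => ?_⟩
  rw [Subgroup.mem_centralizer_iff]
  intro x hx
  have hx' := IsPrimaryElt.of_mem hP hx
  have hy' := IsPrimaryElt.of_mem hQ.isPGroup hy
  rcases eq_or_ne p q with rfl | hpq
  · obtain ⟨k, hk⟩ := hy'
    have h1 : y = 1 := by
      rw [← orderOf_eq_one_iff, ← Nat.dvd_one]
      have h2 : orderOf y ∣ Nat.card L := Subgroup.orderOf_dvd_natCard L (hQ.le hy)
      have h3 : Nat.Coprime (Nat.card L) (p ^ k) :=
        (Nat.Coprime.pow_left _ (hp.coprime_iff_not_dvd.2 hL)).symm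
      rw [← h3]
      exact Nat.dvd_gcd h2 (orderOf_dvd_of_pow_eq_one hk)
    simp [h1]
  · exact hS p q hp hq hpq x (hPS hx) y (hLS (hQ.le hy)) hx' hy'

lemma PrimaryCommute.le_normalizer {p : ℕ} (hp : p.Prime) {S P : Subgroup G}
    (hS : PrimaryCommute S) (hP : IsSylowIn p P S) : S ≤ Subgroup.normalizer (P : Set G) := by
  refine le_of_isSylowIn fun q hq => ?_
  rcases eq_or_ne p q with rfl | hpq
  · exact ⟨P, hP, Subgroup.le_normalizer⟩
  · obtain ⟨Q, hQ⟩ := exists_isSylowIn hq S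
    refine ⟨Q, hQ, (PrimaryCommute.le_centralizer hp hS hP.le hP.isPGroup hQ.le ?_).trans
      (Subgroup.centralizer_le_normalizer (P : Set G))⟩
    exact fun h => hpq (IsPGroup.eq_of_prime_dvd_card hq hp hQ.isPGroup h)

lemma PrimaryCommute.le_sylow {p : ℕ} (hp : p.Prime) {S P Q : Subgroup G}
    (hS : PrimaryCommute S) (hP : IsSylowIn p P S) (hQS : Q ≤ S) (hQ : IsPGroup p Q) : Q ≤ P := by
  obtain ⟨k, hk, h⟩ := hP.exists_conj hp hQS hQ
  rwa [conj_smul_of_mem_normalizer (hS.le_normalizer hp hP hk)] at h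

/-- The Sylow subgroups of a nilpotent group are normalized by everything normalizing the group. -/
lemma PrimaryCommute.normalizer_le {p : ℕ} (hp : p.Prime) {S P : Subgroup G}
    (hS : PrimaryCommute S) (hP : IsSylowIn p P S) :
    Subgroup.normalizer (S : Set G) ≤ Subgroup.normalizer (P : Set G) := by
  intro g hg
  refine mem_normalizer_of_conj_smul_le (hS.le_sylow hp hP ?_ (IsPGroup.conj_smul hP.isPGroup g))
  exact (conj_smul_mono g hP.le).trans (conj_smul_of_mem_normalizer hg).le

lemma isNilpotent_iff_primaryCommute {S : Subgroup G} :
    Group.IsNilpotent S ↔ PrimaryCommute S := by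
  refine ⟨fun h p q hp hq hpq x hx y hy hpx hqy => ?_, fun h => ?_⟩
  · have := Fact.mk hp
    have := Fact.mk hq
    obtain ⟨P, hP⟩ := (hpx.isPGroup_zpowers.comap_subtype (K := S)).exists_le_sylow
    obtain ⟨Q, hQ⟩ := (hqy.isPGroup_zpowers.comap_subtype (K := S)).exists_le_sylow
    have hd := IsPGroup.disjoint_of_ne p q hpq (P : Subgroup S) (Q : Subgroup S) P.2 Q.2
    have := Subgroup.commute_of_normal_of_disjoint _ _ inferInstance inferInstance hd
      ⟨x, hx⟩ ⟨y, hy⟩ (hP (Subgroup.mem_comap.2 (Subgroup.mem_zpowers x)))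
      (hQ (Subgroup.mem_comap.2 (Subgroup.mem_zpowers y)))
    exact this.map S.subtype
  · refine (Group.isNilpotent_of_finite_tfae.out 0 3 rfl rfl).2 fun p hp P => ?_
    have h1 : IsSylowIn p ((P : Subgroup S).map S.subtype) S :=
      ⟨Subgroup.map_subtype_le _, P.2.map _, by
        rw [Subgroup.relIndex, Subgroup.subgroupOf,
          Subgroup.comap_map_eq_self_of_injective S.subtype_injective]
        exact P.not_dvd_index⟩
    have h2 := (Subgroup.normal_subgroupOf_iff_le_normalizer h1.le).2
      (h.le_normalizer hp.out h1)
    rwa [Subgroup.subgroupOf, Subgroup.comap_map_eq_self_of_injective S.subtype_injective] at h2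

/-- Without injectivity, a `p`-element of the image need not have only `p`-elements as preimages, so
the argument goes through nilpotency of quotients. -/
lemma PrimaryCommute.map_of_hom {S : Subgroup G} (hS : PrimaryCommute S) {H : Type*} [Group H]
    [Finite H] (f : G →* H) : PrimaryCommute (S.map f) := by
  have := isNilpotent_iff_primaryCommute.2 hS
  exact isNilpotent_iff_primaryCommute.1
    (Group.nilpotent_of_surjective (f.subgroupMap S) (f.subgroupMap_surjective S))

lemma PrimaryCommute.exists_complement {p : ℕ} (hp : p.Prime) {S P : Subgroup G}
    (hS : PrimaryCommute S) (hP : IsSylowIn p P S) :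
    ∃ L ≤ S, Nat.card L = P.relIndex S ∧ L.relIndex S = Nat.card P := by
  have := Fact.mk hp
  have hn := (Subgroup.normal_subgroupOf_iff_le_normalizer hP.le).2 (hS.le_normalizer hp hP)
  have hcard : Nat.card (P.subgroupOf S) = Nat.card P :=
    Nat.card_congr (Subgroup.subgroupOfEquivOfLe hP.le).toEquiv
  obtain ⟨L, hL⟩ := Subgroup.exists_right_complement'_of_coprime (N := P.subgroupOf S) (by
    rw [hcard]
    obtain ⟨n, hn⟩ := IsPGroup.iff_card.1 hP.isPGroup
    rw [hn]
    exact Nat.Coprime.pow_left _ (hp.coprime_iff_not_dvd.2 hP.not_dvd))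
  refine ⟨L.map S.subtype, Subgroup.map_subtype_le _, ?_, ?_⟩
  · rw [Subgroup.card_map_of_injective S.subtype_injective, Subgroup.relIndex,
      hL.symm.index_eq_card]
  · rw [Subgroup.relIndex, Subgroup.subgroupOf,
      Subgroup.comap_map_eq_self_of_injective S.subtype_injective, hL.index_eq_card, hcard]

end Nilpotent

/-! ### Hall subgroups relative to a subgroup. -/

section Hall

variable {G : Type*} [Group G] {π : Set ℕ}

/-- `H` is a Hall `π`-subgroup of the subgroup `K`. -/
structure IsHallIn (π : Set ℕ) (H K : Subgroup G) : Prop where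
  le : H ≤ K
  isPiSubgroup : IsPiSubgroup π H
  relIndex : IsPiNumber πᶜ (H.relIndex K)

lemma isHallIn_top {H : Subgroup G} : IsHallIn π H ⊤ ↔ IsHall π H :=
  ⟨fun h => ⟨h.2, by simpa using h.3⟩, fun h => ⟨le_top, h.1, by simpa using h.2⟩⟩

lemma isHall_subgroupOf {H K : Subgroup G} (h : H ≤ K) :
    IsHall π (H.subgroupOf K) ↔ IsHallIn π H K := by
  have hcard : Nat.card (H.subgroupOf K) = Nat.card H :=
    Nat.card_congr (Subgroup.subgroupOfEquivOfLe h).toEquiv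
  refine ⟨fun hH => ⟨h, ?_, hH.2⟩, fun hH => ⟨?_, hH.3⟩⟩
  · rw [IsPiSubgroup, ← hcard]
    exact hH.1
  · rw [IsPiSubgroup, hcard]
    exact hH.2

lemma IsPiSubgroup.mono {U V : Subgroup G} (hV : IsPiSubgroup π V) (h : U ≤ V) :
    IsPiSubgroup π U :=
  IsPiNumber.of_dvd hV (Subgroup.card_dvd_of_le h)

lemma IsPiSubgroup.conj_smul {U : Subgroup G} (hU : IsPiSubgroup π U) (g : G) :
    IsPiSubgroup π (MulAut.conj g • U) := by
  rwa [IsPiSubgroup, card_conj_smul]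

lemma IsHallIn.sylow {p : ℕ} (hp : p.Prime) (hpπ : p ∈ π) {P H K : Subgroup G}
    (hH : IsHallIn π H K) (hP : IsSylowIn p P H) : IsSylowIn p P K :=
  hP.trans hp hH.le (isPiNumber_compl_iff.1 hH.3 p hp hpπ)

lemma IsHallIn.conj_smul {H K : Subgroup G} (hH : IsHallIn π H K) {g : G}
    (hg : g ∈ Subgroup.normalizer (K : Set G)) : IsHallIn π (MulAut.conj g • H) K := by
  have hK := conj_smul_of_mem_normalizer hg
  refine ⟨(conj_smul_mono g hH.le).trans hK.le, hH.2.conj_smul g, ?_⟩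
  rw [← hK, Subgroup.relIndex_pointwise_smul]
  exact hH.3

/-- A Hall `π`-subgroup of `N` meets a normal subgroup of `N` in a Hall `π`-subgroup. -/
lemma IsHallIn.inf {H M N : Subgroup G} (hH : IsHallIn π H N) (hMN : M ≤ N)
    (hM : H ≤ Subgroup.normalizer (M : Set G)) : IsHallIn π (H ⊓ M) M := by
  refine ⟨inf_le_right, hH.2.mono inf_le_left, ?_⟩
  rw [Subgroup.inf_relIndex_right, ← relIndex_eq_of_factor (M := H ⊔ M) le_sup_right
    fun m hm => exists_mul_of_mem_sup hM hm]
  exact hH.3.of_dvd (relIndex_dvd_of_le_of_le le_sup_left (sup_le hH.le hMN))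

lemma IsHallIn.card_dvd {H K U : Subgroup G} (hH : IsHallIn π H K) (hU : IsPiSubgroup π U)
    (hUK : U ≤ K) : Nat.card U ∣ Nat.card H := by
  have h := Subgroup.card_dvd_of_le hUK
  rw [← card_mul_relIndex hH.le] at h
  exact (IsPiNumber.coprime hU hH.3).dvd_of_dvd_mul_right h

lemma isHallIn_of_isSylowIn {H K : Subgroup G} (hHK : H ≤ K) (hH : IsPiSubgroup π H)
    (h : ∀ p : ℕ, p.Prime → p ∈ π → ∃ P, IsSylowIn p P K ∧ P ≤ H) : IsHallIn π H K := by
  refine ⟨hHK, hH, isPiNumber_compl_iff.2 fun p hp hpπ hpd => ?_⟩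
  obtain ⟨P, hP, hPH⟩ := h p hp hpπ
  exact hP.not_dvd (hpd.trans (Subgroup.relIndex_dvd_of_le_left _ hPH))

lemma IsPiSubgroup.sup {A B : Subgroup G} (hA : IsPiSubgroup π A) (hB : IsPiSubgroup π B)
    (h : A ≤ Subgroup.normalizer (B : Set G)) : IsPiSubgroup π (A ⊔ B) :=
  (IsPiNumber.mul hA hB).of_dvd (card_sup_dvd h)

variable [Finite G]

lemma IsHallIn.eq_of_le {H K U : Subgroup G} (hH : IsHallIn π H K) (hHU : H ≤ U) (hUK : U ≤ K)
    (hU : IsPiSubgroup π U) : H = U :=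
  Subgroup.eq_of_le_of_card_ge hHU (Nat.le_of_dvd Nat.card_pos (hH.card_dvd hU hUK))

end Hall

/-! ### A nilpotency criterion via fusion and transfer. -/

section MinimalNonNilpotent

open scoped commutatorElement

variable {G : Type*} [Group G]

lemma normalizer_le_normalizer_centralizer (K : Subgroup G) :
    Subgroup.normalizer (K : Set G) ≤
      Subgroup.normalizer (Subgroup.centralizer (K : Set G) : Set G) := by
  rw [Subgroup.le_normalizer_iff]
  intro g hg c hc
  rw [Subgroup.mem_centralizer_iff] at hc ⊢
  intro k hk
  have := hc _ ((Subgroup.mem_normalizer_iff''.1 hg k).1 hk)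
  have h2 : g * (g⁻¹ * k * g * c) * g⁻¹ = g * (c * (g⁻¹ * k * g)) * g⁻¹ := by rw [this]
  simpa [mul_assoc] using h2

variable [Finite G]

lemma lt_inf_normalizer {p : ℕ} (hp : p.Prime) {D P : Subgroup G} (hP : IsPGroup p P)
    (h : D < P) : D < P ⊓ Subgroup.normalizer (D : Set G) := by
  have := Fact.mk hp
  have := hP.isNilpotent
  refine lt_of_le_of_ne (le_inf h.le Subgroup.le_normalizer) fun heq => ?_
  have h1 : D.subgroupOf P < ⊤ := by
    rw [lt_top_iff_ne_top, Ne, Subgroup.subgroupOf_eq_top]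
    exact h.not_ge
  have h2 := Group.normalizerCondition_of_isNilpotent _ h1
  rw [← Subgroup.subgroupOf_normalizer_eq h.le] at h2
  refine h2.not_ge fun x hx => ?_
  rw [Subgroup.mem_subgroupOf] at hx ⊢
  rw [heq]
  exact ⟨x.2, hx⟩

/-- `N(K) / C(K)` is a `p`-group for every `p`-subgroup `K`. -/
def NormalizersActPrimary (G : Type*) [Group G] : Prop :=
  ∀ p q : ℕ, p.Prime → q.Prime → p ≠ q → ∀ K : Subgroup G, IsPGroup p K →
    ∀ y ∈ Subgroup.normalizer (K : Set G), IsPrimaryElt q y → ∀ x ∈ K, Commute x y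

/-- The product `P C(K)` contains a Sylow subgroup of `N(K)` for every prime: `P` itself for `p`,
and for other primes one that centralizes `K`. -/
lemma NormalizersActPrimary.exists_mul (hcent : NormalizersActPrimary G) {p : ℕ} (hp : p.Prime)
    {P K : Subgroup G} (hP : IsSylowIn p P ⊤) (hK : IsPGroup p K)
    (hPK : P ≤ Subgroup.normalizer (K : Set G)) {g : G}
    (hg : g ∈ Subgroup.normalizer (K : Set G)) :
    ∃ y ∈ P, ∃ c ∈ Subgroup.centralizer (K : Set G), g = y * c := by
  refine exists_mul_of_mem_sup (hPK.trans (normalizer_le_normalizer_centralizer K)) ?_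
  refine le_of_isSylowIn (S := Subgroup.normalizer (K : Set G)) (fun q hq => ?_) hg
  rcases eq_or_ne p q with rfl | hpq
  · exact ⟨P, hP.mono hPK le_top, le_sup_left⟩
  · obtain ⟨Q, hQ⟩ := exists_isSylowIn hq (Subgroup.normalizer (K : Set G))
    refine ⟨Q, hQ, le_trans (fun y hy => ?_) le_sup_right⟩
    exact Subgroup.mem_centralizer_iff.2 fun x hx =>
      (hcent p q hp hq hpq K hK y (hQ.le hy) (.of_mem hQ.isPGroup hy) x hx).eq

/-- If proper subgroups are nilpotent, a largest intersection of two Sylow `p`-subgroups is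
normal. -/
lemma normal_of_maximal_sylow_inf (hprop : ∀ K : Subgroup G, K ≠ ⊤ → PrimaryCommute K) {p : ℕ}
    (hp : p.Prime) {P₁ P₂ : Subgroup G} (h₁ : IsSylowIn p P₁ ⊤) (h₂ : IsSylowIn p P₂ ⊤)
    (hne : P₁ ≠ P₂) (hmax : ∀ Q₁ Q₂ : Subgroup G, IsSylowIn p Q₁ ⊤ → IsSylowIn p Q₂ ⊤ → Q₁ ≠ Q₂ →
      Nat.card ↥(Q₁ ⊓ Q₂) ≤ Nat.card ↥(P₁ ⊓ P₂)) :
    Subgroup.normalizer ((P₁ ⊓ P₂ : Subgroup G) : Set G) = ⊤ := by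
  by_contra hN
  set D := P₁ ⊓ P₂ with hD
  set N := Subgroup.normalizer (D : Set G) with hNdef
  obtain ⟨T, hT⟩ := exists_isSylowIn hp N
  obtain ⟨P₃, h₃, hTP₃⟩ := exists_isSylowIn_ge hp (le_top : T ≤ ⊤) hT.isPGroup
  -- `N` is proper, hence nilpotent, with unique Sylow `p`-subgroup `T ≤ P₃`. Normalizers grow in
  -- `P`, so `D < P ⊓ N ≤ P ⊓ P₃`, against maximality unless `P = P₃`. Applied to `P₁` and `P₂`,
  -- this makes them equal.
  have key : ∀ P, IsSylowIn p P ⊤ → D < P → P = P₃ := by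
    intro P hP hDP
    by_contra hne'
    have h4 : P ⊓ N ≤ T :=
      (hprop N hN).le_sylow hp hT inf_le_right (hP.isPGroup.to_le inf_le_left)
    have h5 : D < P ⊓ P₃ :=
      (lt_inf_normalizer hp hP.isPGroup hDP).trans_le (le_inf inf_le_left (h4.trans hTP₃))
    exact h5.not_ge (Subgroup.eq_of_le_of_card_ge h5.le (hmax P P₃ hP h₃ hne')).ge
  have hlt₁ : D < P₁ := lt_of_le_of_ne inf_le_left fun h =>
    hne (h₁.eq_of_le hp (inf_eq_left.1 h) le_top h₂.isPGroup)
  have hlt₂ : D < P₂ := lt_of_le_of_ne inf_le_right fun h =>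
    hne (h₂.eq_of_le hp (inf_eq_right.1 h) le_top h₁.isPGroup).symm
  exact hne ((key P₁ h₁ hlt₁).trans (key P₂ h₂ hlt₂).symm)

/-- Take for `D` a largest intersection of two distinct Sylow `p`-subgroups. Being normal, it lies
in all of them, and maximality makes it equal to every intersection of `P` with a different
conjugate. -/
lemma exists_normal_inf_of_not_normal (hprop : ∀ K : Subgroup G, K ≠ ⊤ → PrimaryCommute K) {p : ℕ}
    (hp : p.Prime) {P : Subgroup G} (hP : IsSylowIn p P ⊤)
    (hPn : Subgroup.normalizer (P : Set G) ≠ ⊤) :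
    ∃ D : Subgroup G, IsPGroup p D ∧ Subgroup.normalizer (D : Set G) = ⊤ ∧
      ∀ g : G, g ∉ Subgroup.normalizer (P : Set G) → P ⊓ MulAut.conj g • P ≤ D := by
  have hconj : ∀ g, IsSylowIn p (MulAut.conj g • P) ⊤ := fun g =>
    hP.of_card_eq hp le_top (card_conj_smul g P)
  have hconj_ne : ∀ g, g ∉ Subgroup.normalizer (P : Set G) → P ≠ MulAut.conj g • P :=
    fun g hg h => hg (mem_normalizer_of_conj_smul_le h.ge)
  let I := {x : Subgroup G × Subgroup G // IsSylowIn p x.1 ⊤ ∧ IsSylowIn p x.2 ⊤ ∧ x.1 ≠ x.2}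
  have : Nonempty I := by
    obtain ⟨g, hg⟩ : ∃ g, g ∉ Subgroup.normalizer (P : Set G) := by
      by_contra! h
      exact hPn ((Subgroup.eq_top_iff' _).2 h)
    exact ⟨⟨(P, MulAut.conj g • P), hP, hconj g, hconj_ne g hg⟩⟩
  obtain ⟨⟨⟨P₁, P₂⟩, h₁, h₂, hne⟩, hmax⟩ :=
    Finite.exists_max (fun x : I => Nat.card ↥(x.1.1 ⊓ x.1.2))
  have hDn := normal_of_maximal_sylow_inf hprop hp h₁ h₂ hne
    fun Q₁ Q₂ hQ₁ hQ₂ hQ => hmax ⟨(Q₁, Q₂), hQ₁, hQ₂, hQ⟩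
  refine ⟨P₁ ⊓ P₂, h₁.isPGroup.to_le inf_le_left, hDn, fun g hg => ?_⟩
  have hle : ∀ Q, IsSylowIn p Q ⊤ → P₁ ⊓ P₂ ≤ Q := by
    intro Q hQ
    obtain ⟨k, -, hk⟩ := hQ.exists_conj hp le_top h₁.isPGroup
    have h4 : MulAut.conj k • (P₁ ⊓ P₂) ≤ MulAut.conj k • Q := by
      rw [conj_smul_of_mem_normalizer (hDn ▸ Subgroup.mem_top k)]
      exact inf_le_left.trans hk
    exact Subgroup.pointwise_smul_le_pointwise_smul_iff.1 h4
  exact (Subgroup.eq_of_le_of_card_ge (le_inf (hle P hP) (hle _ (hconj g)))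
    (hmax ⟨(P, MulAut.conj g • P), hP, hconj g, hconj_ne g hg⟩)).ge

/-- If proper subgroups are nilpotent and `N(K) / C(K)` is a `p`-group for all `p`-subgroups `K`,
then every Sylow `p`-subgroup controls its own fusion. -/
lemma NormalizersActPrimary.fusion (hcent : NormalizersActPrimary G)
    (hprop : ∀ K : Subgroup G, K ≠ ⊤ → PrimaryCommute K) {p : ℕ} (hp : p.Prime) {P : Subgroup G}
    (hP : IsSylowIn p P ⊤) {x g : G} (hx : x ∈ P) (hgx : g * x * g⁻¹ ∈ P) :
    ∃ y ∈ P, g * x * g⁻¹ = y * x * y⁻¹ := by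
  -- `K` is `P` if `g` normalizes `P`; otherwise it is the normal `D`, which contains `x` because `x
  -- ∈ P ∩ g⁻¹ P g`. In either case `g` factors through `P C(K)`, and the `C(K)` part fixes `x`.
  obtain ⟨K, hK, hPK, hgK, hxK⟩ : ∃ K : Subgroup G, IsPGroup p K ∧
      P ≤ Subgroup.normalizer (K : Set G) ∧ g ∈ Subgroup.normalizer (K : Set G) ∧ x ∈ K := by
    by_cases hg : g ∈ Subgroup.normalizer (P : Set G)
    · exact ⟨P, hP.isPGroup, Subgroup.le_normalizer, hg, hx⟩
    · obtain ⟨D, hD, hDn, hDP⟩ := exists_normal_inf_of_not_normal hprop hp hP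
        (fun h => hg (h ▸ Subgroup.mem_top g))
      refine ⟨D, hD, hDn ▸ le_top, hDn ▸ Subgroup.mem_top g,
        hDP g⁻¹ (fun h => hg (inv_mem_iff.1 h)) (Subgroup.mem_inf.2 ⟨hx, mem_conj_smul.2 ?_⟩)⟩
      rwa [inv_inv]
  obtain ⟨y, hy, c, hc, rfl⟩ := hcent.exists_mul hp hP hK hPK hgK
  refine ⟨y, hy, ?_⟩
  have := Subgroup.mem_centralizer_iff.1 hc x hxK
  rw [mul_assoc y c x, ← this]
  group

/-- Control of fusion turns each generator of the focal subgroup into a commutator of elements of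
`P`, and a nontrivial `p`-group is not perfect. -/
lemma NormalizersActPrimary.focalSubgroup_lt (hcent : NormalizersActPrimary G)
    (hprop : ∀ K : Subgroup G, K ≠ ⊤ → PrimaryCommute K) {p : ℕ} (hp : p.Prime) {P : Subgroup G}
    (hP : IsSylowIn p P ⊤) (hne : P ≠ ⊥) : P.focalSubgroup < P := by
  have := Fact.mk hp
  have h1 : P.focalSubgroup ≤ ⁅P, P⁆ := by
    rw [Subgroup.focalSubgroup_def, Subgroup.closure_le]
    rintro _ ⟨h, x, hx, u, rfl⟩
    have h2 : u * x⁻¹ * u⁻¹ ∈ P := by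
      have := mul_mem (inv_mem hx) h
      simpa [commutatorElement_def, mul_assoc] using this
    obtain ⟨y, hy, hxy⟩ := hcent.fusion hprop hp hP (inv_mem hx) h2
    have h3 : ⁅x, u⁆ = ⁅x, y⁆ := by
      rw [commutatorElement_def, commutatorElement_def,
        show x * u * x⁻¹ * u⁻¹ = x * (u * x⁻¹ * u⁻¹) by group, hxy]
      group
    rw [h3]
    exact Subgroup.commutator_mem_commutator hx hy
  refine h1.trans_lt ?_
  have := hP.isPGroup.isNilpotent
  have : Nontrivial P := (Subgroup.nontrivial_iff_ne_bot P).2 hne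
  have h4 := Group.IsSolvable.commutator_lt_top_of_nontrivial P
  rw [← Subgroup.map_subtype_commutator]
  refine lt_of_le_of_ne (Subgroup.map_subtype_le _) fun h => h4.ne ?_
  refine Subgroup.map_injective P.subtype_injective (h.trans ?_)
  rw [← MonoidHom.range_eq_map, Subgroup.range_subtype]

/-- The kernel of the transfer to `P` modulo its focal subgroup is proper, hence nilpotent, and
contains all `q`-elements for `q ≠ p`. Its Sylow `q`-subgroups are therefore normal Sylow subgroups
of `G`; `P` acts trivially on them, so they normalize `P`. -/
lemma NormalizersActPrimary.sylow_normal (hcent : NormalizersActPrimary G)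
    (hprop : ∀ K : Subgroup G, K ≠ ⊤ → PrimaryCommute K) {p : ℕ} (hp : p.Prime) {P : Subgroup G}
    (hP : IsSylowIn p P ⊤) : Subgroup.normalizer (P : Set G) = ⊤ := by
  have := Fact.mk hp
  rcases eq_or_ne P ⊥ with rfl | hne
  · exact Subgroup.normalizer_eq_top _
  let P' : Sylow p G := hP.isPGroup.toSylow (by simpa using hP.not_dvd)
  have hcod : IsPGroup p (P' ⧸ P'.focalSubgroupOf) := P'.2.to_quotient _
  set M := P'.transferFocal.ker with hM
  have hMtop : M ≠ ⊤ := by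
    intro h
    have h1 := Subgroup.ker_transferFocal_inf_eq_focalSubgroup P'
    rw [← hM, h, top_inf_eq] at h1
    exact (hcent.focalSubgroup_lt hprop hp hP hne).ne h1.symm
  rw [eq_top_iff]
  refine le_of_isSylowIn fun q hq => ?_
  rcases eq_or_ne p q with rfl | hpq
  · exact ⟨P, hP, Subgroup.le_normalizer⟩
  obtain ⟨Q, hQ⟩ := exists_isSylowIn hq (⊤ : Subgroup G)
  have hQM : Q ≤ M := fun y hy =>
    ((IsPrimaryElt.of_mem hQ.isPGroup hy).map P'.transferFocal).eq_one hq hp hpq.symm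
      (hcod (P'.transferFocal y))
  have hQn : Subgroup.normalizer (Q : Set G) = ⊤ := by
    rw [eq_top_iff, ← Subgroup.normalizer_eq_top (H := M)]
    exact (hprop M hMtop).normalizer_le hq (hQ.mono hQM le_top)
  refine ⟨Q, hQ, le_trans (fun y hy => ?_) (Subgroup.centralizer_le_normalizer (P : Set G))⟩
  exact Subgroup.mem_centralizer_iff.2 fun x hx =>
    (hcent q p hq hp hpq.symm Q hQ.isPGroup x (hQn ▸ Subgroup.mem_top x)
      (.of_mem hP.isPGroup hx) y hy).eq.symm

/-- A group whose proper subgroups are nilpotent, and where `N(K) / C(K)` is a `p`-group for every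
`p`-subgroup `K`, is nilpotent. -/
theorem NormalizersActPrimary.primaryCommute_top (hcent : NormalizersActPrimary G)
    (hprop : ∀ K : Subgroup G, K ≠ ⊤ → PrimaryCommute K) : PrimaryCommute (⊤ : Subgroup G) := by
  intro p q hp hq hpq x _ y _ hx hy
  obtain ⟨P, hP, hxP⟩ := exists_isSylowIn_ge hp (le_top : Subgroup.zpowers x ≤ ⊤)
    hx.isPGroup_zpowers
  exact hcent p q hp hq hpq P hP.isPGroup y
    (hcent.sylow_normal hprop hp hP ▸ Subgroup.mem_top y) hy x (hxP (Subgroup.mem_zpowers x))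

end MinimalNonNilpotent

/-! ### Wielandt's theorem and existence of Hall subgroups. -/

section Wielandt

variable {G : Type*} [Group G] {π : Set ℕ}

lemma IsPiSubgroup.mem_of_isPrimaryElt {U : Subgroup G} (hU : IsPiSubgroup π U) {p : ℕ}
    (hp : p.Prime) {x : G} (hxU : x ∈ U) (hx : IsPrimaryElt p x) (hx1 : x ≠ 1) : p ∈ π := by
  obtain ⟨k, hk⟩ := hx
  obtain ⟨m, -, hm⟩ := (Nat.dvd_prime_pow hp).1 (orderOf_dvd_of_pow_eq_one hk)
  have hm0 : m ≠ 0 := by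
    rintro rfl
    exact hx1 (orderOf_eq_one_iff.1 (by simpa using hm))
  refine isPiNumber_iff.1 hU p hp (dvd_trans ?_ (Subgroup.orderOf_dvd_natCard U hxU))
  rw [hm]
  exact dvd_pow_self p hm0

variable [Finite G]

/-- A `p`-subgroup lies in a conjugate of a Hall `π`-subgroup whenever `p ∈ π`. -/
lemma IsHallIn.exists_conj_of_isPGroup {p : ℕ} (hp : p.Prime) (hpπ : p ∈ π) {S K P : Subgroup G}
    (hS : IsHallIn π S K) (hPK : P ≤ K) (hP : IsPGroup p P) :
    ∃ k ∈ K, P ≤ MulAut.conj k • S := by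
  obtain ⟨R, hR⟩ := exists_isSylowIn hp S
  obtain ⟨k, hk, hle⟩ := (hS.sylow hp hpπ hR).exists_conj hp hPK hP
  exact ⟨k, hk, hle.trans (conj_smul_mono k hR.le)⟩

/-- Some conjugate of `S` contains `P`, and its Sylow `q`-subgroup `Q` centralizes `P`. Since `Q` is
also Sylow in `N_K(P)`, an element of `N_K(P)` conjugates `y` into `Q`, and `C(P)` is invariant
under `N(P)`. -/
lemma IsHallIn.commute_of_mem_normalizer {S K U : Subgroup G} (hS : IsHallIn π S K)
    (hSn : PrimaryCommute S) (hU : IsPiSubgroup π U) (hUK : U ≤ K) {p q : ℕ} (hp : p.Prime)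
    (hq : q.Prime) (hpq : p ≠ q) {P : Subgroup G} (hPU : P ≤ U) (hP : IsPGroup p P) {y : G}
    (hyU : y ∈ U) (hyP : y ∈ Subgroup.normalizer (P : Set G)) (hy : IsPrimaryElt q y) {x : G}
    (hx : x ∈ P) : Commute x y := by
  rcases eq_or_ne x 1 with rfl | hx1
  · exact Commute.one_left y
  rcases eq_or_ne y 1 with rfl | hy1
  · exact Commute.one_right x
  have hpπ := hU.mem_of_isPrimaryElt hp (hPU hx) (.of_mem hP hx) hx1
  have hqπ := hU.mem_of_isPrimaryElt hq hyU hy hy1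
  obtain ⟨k, hk, hPS⟩ := hS.exists_conj_of_isPGroup hp hpπ (hPU.trans hUK) hP
  have hS' := hS.conj_smul (Subgroup.le_normalizer hk)
  obtain ⟨Q, hQ⟩ := exists_isSylowIn hq (MulAut.conj k • S)
  have hQC : Q ≤ Subgroup.centralizer (P : Set G) :=
    (hSn.conj_smul k).le_centralizer hp hPS hP hQ.le
      fun h => hpq (IsPGroup.eq_of_prime_dvd_card hq hp hQ.isPGroup h)
  have hQN : IsSylowIn q Q (K ⊓ Subgroup.normalizer (P : Set G)) :=
    (hS'.sylow hq hqπ hQ).mono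
      (le_inf (hQ.le.trans hS'.le) (hQC.trans (Subgroup.centralizer_le_normalizer _)))
      inf_le_left
  obtain ⟨n, hn, hle⟩ := hQN.exists_conj hq
    (Subgroup.zpowers_le.2 (Subgroup.mem_inf.2 ⟨hUK hyU, hyP⟩)) hy.isPGroup_zpowers
  have hyC : y ∈ Subgroup.centralizer (P : Set G) := by
    rw [← conj_smul_of_mem_normalizer
      (normalizer_le_normalizer_centralizer P (Subgroup.mem_inf.1 hn).2)]
    exact conj_smul_mono n hQC (hle (Subgroup.mem_zpowers y))
  exact Subgroup.mem_centralizer_iff.1 hyC x hx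

/-- Wielandt's theorem: if `S` is a nilpotent Hall `π`-subgroup of `K`, then every `π`-subgroup of
`K` lies in a conjugate of `S`. -/
theorem IsHallIn.exists_conj_of_primaryCommute {S K U : Subgroup G} (hS : IsHallIn π S K)
    (hSn : PrimaryCommute S) (hUK : U ≤ K) (hU : IsPiSubgroup π U) :
    ∃ k ∈ K, U ≤ MulAut.conj k • S := by
  induction hn : Nat.card U using Nat.strong_induction_on generalizing U K S π with
  | _ n ih =>
  subst hn
  -- By induction the proper subgroups of `U` lie in conjugates of `S`, so they are nilpotent and
  -- the criterion applies to `U`.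
  have hUn : PrimaryCommute U := by
    have hcent : NormalizersActPrimary U := by
      intro p q hp hq hpq P hP y hyP hy x hx
      have := hS.commute_of_mem_normalizer hSn hU hUK hp hq hpq (Subgroup.map_subtype_le P)
        (hP.map U.subtype) y.2 (Subgroup.le_normalizer_map U.subtype
          (Subgroup.mem_map_of_mem U.subtype hyP)) (hy.map U.subtype)
        (Subgroup.mem_map_of_mem U.subtype hx)
      exact Subtype.ext this
    have hprop : ∀ V : Subgroup U, V ≠ ⊤ → PrimaryCommute V := by
      intro V hV
      have hcard : Nat.card (V.map U.subtype) < Nat.card U := by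
        rw [Subgroup.card_map_of_injective U.subtype_injective]
        exact lt_of_le_of_ne (Subgroup.card_le_card_group V) fun h =>
          hV (Subgroup.eq_top_of_card_eq V h)
      obtain ⟨k, -, hk⟩ := ih _ hcard hS hSn ((Subgroup.map_subtype_le V).trans hUK)
        (hU.mono (Subgroup.map_subtype_le V)) rfl
      have := ((hSn.conj_smul k).mono hk).comap U.subtype U.subtype_injective
      rwa [Subgroup.comap_map_eq_self_of_injective U.subtype_injective] at this
    have := (hcent.primaryCommute_top hprop).map U.subtype U.subtype_injective
    rwa [← MonoidHom.range_eq_map, Subgroup.range_subtype] at this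
  rcases eq_or_ne U ⊥ with rfl | hne
  · exact ⟨1, one_mem K, bot_le⟩
  obtain ⟨p, hp, hpU⟩ := Nat.exists_prime_and_dvd (n := Nat.card U)
    fun h => hne (Subgroup.card_eq_one.1 h)
  have hpπ : p ∈ π := isPiNumber_iff.1 hU p hp hpU
  obtain ⟨P, hP⟩ := exists_isSylowIn hp U
  obtain ⟨k, hk, hPS⟩ := hS.exists_conj_of_isPGroup hp hpπ (hP.le.trans hUK) hP.isPGroup
  have hS' := hS.conj_smul (Subgroup.le_normalizer hk)
  have hSn' := hSn.conj_smul k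
  obtain ⟨P₁, hP₁⟩ := exists_isSylowIn hp (MulAut.conj k • S)
  obtain ⟨L, hLS, hL, hLP⟩ := hSn'.exists_complement hp hP₁
  obtain ⟨Q, hQU, hQ, hQP⟩ := hUn.exists_complement hp hP
  have hpL : ¬ p ∣ Nat.card L := hL ▸ hP₁.not_dvd
  have hpQ : ¬ p ∣ Nat.card Q := hQ ▸ hP.not_dvd
  have hLC := hSn'.le_centralizer hp hPS hP.isPGroup hLS hpL
  have hQC := hUn.le_centralizer hp hP.le hP.isPGroup hQU hpQ
  have hpi : ∀ V : Subgroup G, IsPiSubgroup π V → ¬ p ∣ Nat.card V → IsPiSubgroup (π \ {p}) V :=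
    fun V hV hpV => isPiNumber_iff.2 fun r hr hrV =>
      ⟨isPiNumber_iff.1 hV r hr hrV, fun h => hpV (h ▸ hrV)⟩
  -- `|K : L|` is `|P₁|` times a `π'`-number. The induction is then used for the smaller set `π \
  -- {p}` inside `C_K(P)`: its conjugator `c` moves the complement `Q` of `P` into place while
  -- fixing `P`.
  have hLH : IsHallIn (π \ {p}) L (K ⊓ Subgroup.centralizer (P : Set G)) := by
    refine ⟨le_inf (hLS.trans hS'.le) hLC, hpi L (hS'.2.mono hLS) hpL,
      isPiNumber_compl_iff.2 fun r hr hrπ hrL => ?_⟩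
    have h1 : r ∣ L.relIndex K := hrL.trans
      (relIndex_dvd_of_le_of_le (le_inf (hLS.trans hS'.le) hLC) inf_le_left)
    rw [← Subgroup.relIndex_mul_relIndex L _ K hLS hS'.le, hr.dvd_mul, hLP] at h1
    rcases h1 with h1 | h1
    · exact hrπ.2 (IsPGroup.eq_of_prime_dvd_card hp hr hP₁.isPGroup h1)
    · exact isPiNumber_compl_iff.1 hS'.3 r hr hrπ.1 h1
  have hQlt : Nat.card Q < Nat.card U := by
    refine lt_of_le_of_ne (Subgroup.card_le_of_le hQU) fun h => hpQ (h ▸ hpU)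
  obtain ⟨c, hc, hQL⟩ := ih _ hQlt hLH (hSn'.mono hLS) (le_inf (hQU.trans hUK) hQC)
    (hpi Q (hU.mono hQU) hpQ) rfl
  refine ⟨c * k, mul_mem (Subgroup.mem_inf.1 hc).1 hk, le_of_isSylowIn fun r hr => ?_⟩
  rw [conj_smul_mul]
  rcases eq_or_ne r p with rfl | hrp
  · refine ⟨P, hP, ?_⟩
    rw [← conj_smul_of_mem_normalizer
      (Subgroup.centralizer_le_normalizer _ (Subgroup.mem_inf.1 hc).2)]
    exact conj_smul_mono c hPS
  · obtain ⟨R, hR⟩ := exists_isSylowIn hr Q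
    refine ⟨R, hR.trans hr hQU fun h => hrp ?_, hR.le.trans (hQL.trans (conj_smul_mono c hLS))⟩
    exact IsPGroup.eq_of_prime_dvd_card hp hr hP.isPGroup (hQP ▸ h)

lemma IsHallIn.exists_eq_conj_of_primaryCommute {S K U : Subgroup G} (hS : IsHallIn π S K)
    (hSn : PrimaryCommute S) (hU : IsHallIn π U K) : ∃ k ∈ K, U = MulAut.conj k • S := by
  obtain ⟨k, hk, h⟩ := hS.exists_conj_of_primaryCommute hSn hU.le hU.2
  exact ⟨k, hk, hU.eq_of_le h (conj_smul_le_self hS.le hk) (hS.2.conj_smul k)⟩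

/-- A normal subgroup of `π`-index with a nilpotent Hall `π`-subgroup yields a Hall `π`-subgroup of
the whole group. -/
theorem exists_isHall_of_normal {X S : Subgroup G} [X.Normal] (hS : IsHallIn π S X)
    (hSn : PrimaryCommute S) (hX : IsPiNumber π X.index) : ∃ E : Subgroup G, IsHall π E := by
  set N := Subgroup.normalizer (S : Set G) with hN
  -- Frattini argument: `g⁻¹ S g` is a Hall subgroup of `X`, hence equals `x S x⁻¹` with `x ∈ X`,
  -- and `g x` normalizes `S`.
  have hfactor : ∀ g : G, ∃ n ∈ N, ∃ x ∈ X, g = n * x := by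
    intro g
    have h1 := hS.conj_smul (g := g⁻¹) (Subgroup.normalizer_eq_top X ▸ Subgroup.mem_top _)
    obtain ⟨x, hx, h⟩ := hS.exists_eq_conj_of_primaryCommute hSn h1
    refine ⟨g * x, ?_, x⁻¹, inv_mem hx, by group⟩
    refine mem_normalizer_of_conj_smul_le ?_
    rw [conj_smul_mul, ← h, ← conj_smul_mul, mul_inv_cancel, map_one, one_smul]
  have hNX : N ⊔ X = ⊤ := by
    refine (Subgroup.eq_top_iff' _).2 fun g => ?_
    obtain ⟨n, hn, x, hx, rfl⟩ := hfactor g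
    exact Subgroup.mul_mem_sup hn hx
  let f := QuotientGroup.mk' (S.subgroupOf N)
  have hf : Function.Surjective f := QuotientGroup.mk'_surjective _
  have hker : f.ker = S.subgroupOf N := QuotientGroup.ker_mk' _
  -- In `N / S` the image `M` of `N ∩ X` has `π'`-order and `π`-index, so Schur–Zassenhaus supplies
  -- a complement; its preimage is the Hall subgroup sought.
  set M := (X.subgroupOf N).map f with hM
  have hMn : M.Normal := Subgroup.Normal.map inferInstance f hf
  have hle : f.ker ≤ X.subgroupOf N := hker.le.trans (Subgroup.comap_mono hS.le)
  have hMindex : M.index = X.index := by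
    rw [hM, Subgroup.index_map_eq _ hf hle,
      ← Subgroup.relIndex, ← Subgroup.relIndex_sup_right, hNX, Subgroup.relIndex_top_right]
  have hMcard : IsPiNumber πᶜ (Nat.card M) := by
    rw [hM, ← Subgroup.relIndex_ker, hker, ← Subgroup.inf_subgroupOf_right X N,
      Subgroup.relIndex_subgroupOf inf_le_right]
    exact hS.3.of_dvd (relIndex_dvd_of_le_of_le (le_inf hS.le Subgroup.le_normalizer) inf_le_left)
  obtain ⟨C, hC⟩ := Subgroup.exists_right_complement'_of_coprime (N := M)
    (hMindex ▸ (IsPiNumber.coprime hX hMcard).symm)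
  have hCcard : Nat.card C = X.index := by rw [← hMindex, hC.symm.index_eq_card]
  have hCindex : C.index = Nat.card M := hC.index_eq_card
  have hfC : f.ker ≤ C.comap f := Subgroup.ker_le_comap f C
  refine ⟨(C.comap f).map N.subtype, ?_, ?_⟩
  · rw [IsPiSubgroup, Subgroup.card_map_of_injective N.subtype_injective,
      ← card_mul_relIndex hfC, Subgroup.relIndex_ker, Subgroup.map_comap_eq_self_of_surjective hf,
      hCcard, hker, Nat.card_congr (Subgroup.subgroupOfEquivOfLe Subgroup.le_normalizer).toEquiv]
    exact IsPiNumber.mul hS.2 hX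
  · rw [Subgroup.index_map_subtype, Subgroup.index_comap_of_surjective _ hf, hCindex]
    refine hMcard.mul ?_
    rw [← Subgroup.relIndex_top_right,
      relIndex_eq_of_factor (B := X) le_top fun g _ => hfactor g]
    exact hS.3.of_dvd (Subgroup.relIndex_dvd_of_le_left X Subgroup.le_normalizer)

end Wielandt

/-! ### The largest normal `p`-subgroup of a `π`-subgroup. -/

section Core

variable {G : Type*} [Group G]

/-- `Z` is the largest `p`-subgroup of `U` normalized by `U`. -/
structure IsCore (p : ℕ) (Z U : Subgroup G) : Prop where
  le : Z ≤ U
  isPGroup : IsPGroup p Z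
  le_normalizer : U ≤ Subgroup.normalizer (Z : Set G)
  max : ∀ Y : Subgroup G, Y ≤ U → IsPGroup p Y → U ≤ Subgroup.normalizer (Y : Set G) → Y ≤ Z

variable [Finite G]

lemma exists_isCore (p : ℕ) (U : Subgroup G) : ∃ Z, IsCore p Z U := by
  let I := {Z : Subgroup G // Z ≤ U ∧ IsPGroup p Z ∧ U ≤ Subgroup.normalizer (Z : Set G)}
  have : Nonempty I := ⟨⟨⊥, bot_le, IsPGroup.of_bot, (Subgroup.normalizer_eq_top (⊥ : Subgroup G)).ge.trans' le_top⟩⟩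
  obtain ⟨⟨Z, hZU, hZ, hUZ⟩, hmax⟩ := Finite.exists_max (fun Z : I => Nat.card Z.1)
  refine ⟨Z, hZU, hZ, hUZ, fun Y hYU hY hUY => ?_⟩
  have h1 := hmax ⟨Y ⊔ Z, sup_le hYU hZU, IsPGroup.to_sup_of_normal_right' hY hZ (hYU.trans hUZ),
    (le_inf hUY hUZ).trans (Subgroup.normalizer_inf_normalizer_le_normalizer_sup Y Z)⟩
  exact le_sup_left.trans (Subgroup.eq_of_le_of_card_ge le_sup_right h1).ge

lemma exists_isPGroup_normalized {U A : Subgroup G}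
    (hUA : U ≤ Subgroup.normalizer (A : Set G)) (hA : PrimaryCommute A) {p : ℕ} (hp : p.Prime)
    (hpA : p ∣ Nat.card A) :
    ∃ Y ≤ A, IsPGroup p Y ∧ U ≤ Subgroup.normalizer (Y : Set G) ∧ Y ≠ ⊥ := by
  obtain ⟨R, hR⟩ := exists_isSylowIn hp A
  refine ⟨R, hR.le, hR.isPGroup, hUA.trans (hA.normalizer_le hp hR), ?_⟩
  rintro rfl
  exact hR.not_dvd (by simpa using hpA)

/-- A nontrivial nilpotent-by-soluble group has a nontrivial normal `p`-subgroup for some `p`. -/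
lemma exists_core_ne_bot {U X : Subgroup G} (hU : U ≠ ⊥) {d : ℕ} (hd : derivedSeries G d ≤ X)
    (hUX : PrimaryCommute (U ⊓ X)) : ∃ p, p.Prime ∧ ∃ Z, IsCore p Z U ∧ Z ≠ ⊥ := by
  classical
  let D : ℕ → Subgroup G := fun n => (derivedSeries U n).map U.subtype
  have hDU : ∀ n, D n ≤ U := fun n => Subgroup.map_subtype_le _
  have hDn : ∀ n, U ≤ Subgroup.normalizer (D n : Set G) := fun n => by
    rw [← Subgroup.normal_subgroupOf_iff_le_normalizer (hDU n), Subgroup.subgroupOf,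
      Subgroup.comap_map_eq_self_of_injective U.subtype_injective]
    infer_instance
  have hex : ∃ n, PrimaryCommute (D n) :=
    ⟨d, hUX.mono (le_inf (hDU d) ((map_derivedSeries_le_derivedSeries U.subtype d).trans hd))⟩
  obtain ⟨A, hAU, hUA, hAn, hA⟩ : ∃ A ≤ U, U ≤ Subgroup.normalizer (A : Set G) ∧
      PrimaryCommute A ∧ A ≠ ⊥ := by
    -- `A` is the first nilpotent term of the derived series of `U`. Were it trivial, either `U`
    -- would be trivial or the preceding term would be abelian, hence already nilpotent.
    refine ⟨D (Nat.find hex), hDU _, hDn _, Nat.find_spec hex, fun hbot => ?_⟩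
    rcases hn : Nat.find hex with _ | m
    · rw [hn] at hbot
      refine hU ?_
      rw [← hbot]
      simp only [D, derivedSeries_zero]
      rw [← MonoidHom.range_eq_map, Subgroup.range_subtype]
    · refine Nat.find_min hex (m := m) (by omega) fun p q hp hq hpq x hx y hy _ _ => ?_
      rw [hn] at hbot
      obtain ⟨x, hx, rfl⟩ := hx
      obtain ⟨y, hy, rfl⟩ := hy
      have h1 : derivedSeries U (m + 1) = ⊥ :=
        (Subgroup.map_eq_bot_iff_of_injective _ U.subtype_injective).1 hbot
      rw [derivedSeries_succ] at h1
      have h2 := Subgroup.commutator_mem_commutator hx hy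
      rw [h1, Subgroup.mem_bot, commutatorElement_eq_one_iff_commute] at h2
      exact h2.map U.subtype
  obtain ⟨p, hp, hpA⟩ := Nat.exists_prime_and_dvd (n := Nat.card A)
    fun h => hA (Subgroup.card_eq_one.1 h)
  obtain ⟨Y, hYA, hY, hUY, hne⟩ := exists_isPGroup_normalized hUA hAn hp hpA
  obtain ⟨Z, hZ⟩ := exists_isCore p U
  exact ⟨p, hp, Z, hZ, fun h => hne (le_bot_iff.1 (h ▸ hZ.max Y (hYA.trans hAU) hY hUY))⟩

/-- Unless `U` is a `p`-group or `X` is everything, the nontrivial core can be chosen such that it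
does not supplement `X`. -/
lemma exists_core_sup_ne_top {U X : Subgroup G} [X.Normal] (hXtop : X ≠ ⊤)
    {d : ℕ} (hd : derivedSeries G d ≤ X) (hVn : PrimaryCommute (U ⊓ X)) :
    (∃ p, p.Prime ∧ IsPGroup p U) ∨
      ∃ p, p.Prime ∧ ∃ Z, IsCore p Z U ∧ Z ≠ ⊥ ∧ Z ⊔ X ≠ ⊤ := by
  by_cases hU : U = ⊥
  · exact Or.inl ⟨2, Nat.prime_two, hU ▸ IsPGroup.of_bot⟩
  -- A `p`-group supplementing `X` makes `|G : X|` a power of `p`. Hence cores for two different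
  -- primes cannot both supplement the proper subgroup `X`.
  have hindex : ∀ p, p.Prime → ∀ Z : Subgroup G, IsPGroup p Z → Z ⊔ X = ⊤ →
      ∀ r, r.Prime → r ∣ X.index → r = p := by
    intro p hp Z hZ hZX r hr hrX
    refine IsPGroup.eq_of_prime_dvd_card hp hr hZ (hrX.trans ?_)
    rw [← Subgroup.relIndex_top_right, ← hZX, Subgroup.relIndex_sup_right]
    exact Subgroup.relIndex_dvd_card _ _
  obtain ⟨q, hq, Z, hZ, hZne⟩ := exists_core_ne_bot hU hd hVn
  by_cases hZX : Z ⊔ X = ⊤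
  swap
  · exact Or.inr ⟨q, hq, Z, hZ, hZne, hZX⟩
  by_cases hV : ∀ r, r.Prime → r ∣ Nat.card ↥(U ⊓ X) → r = q
  · refine Or.inl ⟨q, hq, isPGroup_of_forall_prime fun r hr hrU => ?_⟩
    rw [← card_mul_relIndex (inf_le_left : U ⊓ X ≤ U), Subgroup.inf_relIndex_left,
      hr.dvd_mul] at hrU
    rcases hrU with h | h
    · exact hV r hr h
    · refine hindex q hq Z hZ.isPGroup hZX r hr (h.trans (Subgroup.relIndex_dvd_index_of_normal _ _))
  · push Not at hV
    obtain ⟨r, hr, hrV, hrq⟩ := hV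
    have hUV : U ≤ Subgroup.normalizer ((U ⊓ X : Subgroup G) : Set G) := by
      rw [Subgroup.le_normalizer_iff]
      intro u hu v hv
      rw [Subgroup.mem_inf] at hv ⊢
      exact ⟨mul_mem (mul_mem hu hv.1) (inv_mem hu),
        Subgroup.Normal.conj_mem inferInstance v hv.2 u⟩
    obtain ⟨Y, hYV, hY, hUY, hne⟩ := exists_isPGroup_normalized hUV hVn hr hrV
    obtain ⟨W, hW⟩ := exists_isCore r U
    refine Or.inr ⟨r, hr, W, hW, fun h =>
      hne (le_bot_iff.1 (h ▸ hW.max Y (hYV.trans inf_le_left) hY hUY)), fun hWX => hXtop ?_⟩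
    rw [← Subgroup.index_eq_one]
    exact eq_one_of_forall_prime_not_dvd fun s hs hsX =>
      hrq ((hindex r hr W hW.isPGroup hWX s hs hsX).symm.trans
        (hindex q hq Z hZ.isPGroup hZX s hs hsX))

end Core

/-! ### Hall subgroups and the normalizer of a `q`-subgroup. -/

section HallNormalizer

variable {G : Type*} [Group G] {π : Set ℕ}

lemma le_normalizer_of_normal (A X : Subgroup G) [X.Normal] :
    A ≤ Subgroup.normalizer (X : Set G) :=
  le_top.trans (Subgroup.normalizer_eq_top X).ge

lemma inf_le_normalizer {A B C : Subgroup G} (hAB : A ≤ Subgroup.normalizer (B : Set G))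
    (hAC : A ≤ Subgroup.normalizer (C : Set G)) :
    A ≤ Subgroup.normalizer ((B ⊓ C : Subgroup G) : Set G) := by
  rw [Subgroup.le_normalizer_iff] at hAB hAC ⊢
  exact fun a ha x hx => Subgroup.mem_inf.2
    ⟨hAB a ha x (Subgroup.mem_inf.1 hx).1, hAC a ha x (Subgroup.mem_inf.1 hx).2⟩

/-- The index of `E X` divides both a `π`-number and a `π'`-number. -/
lemma isHall_sup_eq_top {E X : Subgroup G} (hE : IsHall π E) (hX : IsPiNumber π X.index) :
    E ⊔ X = ⊤ := by
  rw [← Subgroup.index_eq_one]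
  have := IsPiNumber.coprime (hX.of_dvd (Subgroup.index_dvd_of_le (le_sup_right : X ≤ E ⊔ X)))
    (hE.2.of_dvd (Subgroup.index_dvd_of_le (le_sup_left : E ≤ E ⊔ X)))
  exact (Nat.coprime_self _).1 this

lemma exists_mul_of_sup_eq_top {A X : Subgroup G} [X.Normal] (h : A ⊔ X = ⊤) (g : G) :
    ∃ a ∈ A, ∃ x ∈ X, g = a * x :=
  exists_mul_of_mem_sup (le_normalizer_of_normal A X) (h ▸ Subgroup.mem_top g)

/-- A `p`-group normalizing the `q`-group `Z` and lying in a `Z`-invariant `p`-group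
centralizes `Z`. -/
lemma commute_of_normalize {p q : ℕ} (hp : p.Prime) (hq : q.Prime) (hpq : p ≠ q)
    {W Z P : Subgroup G} (hZ : IsPGroup q Z) (hP : IsPGroup p P) (hWP : W ≤ P)
    (hWZ : W ≤ Subgroup.normalizer (Z : Set G)) (hZP : Z ≤ Subgroup.normalizer (P : Set G)) :
    W ≤ Subgroup.centralizer (Z : Set G) := by
  intro w hw
  refine Subgroup.mem_centralizer_iff.2 fun z hz => ?_
  have h1 : z * w * z⁻¹ * w⁻¹ ∈ P :=
    mul_mem (Subgroup.le_normalizer_iff.1 hZP z hz w (hWP hw)) (inv_mem (hWP hw))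
  have h2 : z * w * z⁻¹ * w⁻¹ ∈ Z := by
    have := mul_mem hz (Subgroup.le_normalizer_iff.1 hWZ w hw z⁻¹ (inv_mem hz))
    simpa [mul_assoc] using this
  have h3 := (IsPrimaryElt.of_mem hP h1).eq_one hp hq hpq (.of_mem hZ h2)
  rwa [mul_inv_eq_one, mul_inv_eq_iff_eq_mul] at h3

variable [Finite G]

/-- If `S = E ∩ X` is a nilpotent Hall subgroup of the normal subgroup `X`, and `E` contains `Z` and
a Sylow `q`-subgroup of `N_X(Z)`, then `N_S(Z)` is a Hall subgroup of `N_X(Z)`. -/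
lemma isHallIn_inf_normalizer {X E Z R : Subgroup G} [X.Normal] (hE : IsHall π E)
    (hSn : PrimaryCommute (E ⊓ X)) {q : ℕ} (hq : q.Prime) (hqπ : q ∈ π)
    (hZ : IsPGroup q Z) (hZE : Z ≤ E) (hZX : (Z ⊔ X).Normal)
    (hR : IsSylowIn q R (X ⊓ Subgroup.normalizer (Z : Set G))) (hRE : R ≤ E)
    (hdom : ∀ W : Subgroup G, W ≤ Z ⊔ X → IsPiSubgroup π W →
      ∃ g ∈ Z ⊔ X, W ≤ MulAut.conj g • (E ⊓ (Z ⊔ X))) :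
    IsHallIn π (E ⊓ X ⊓ Subgroup.normalizer (Z : Set G))
      (X ⊓ Subgroup.normalizer (Z : Set G)) := by
  set N := Subgroup.normalizer (Z : Set G) with hN
  set S := E ⊓ X with hSdef
  set G₀ := Z ⊔ X with hG₀
  have hES : E ≤ Subgroup.normalizer (S : Set G) :=
    inf_le_normalizer Subgroup.le_normalizer (le_normalizer_of_normal E X)
  refine isHallIn_of_isSylowIn (inf_le_inf_right N inf_le_right)
    (hE.1.mono (inf_le_left.trans inf_le_left)) fun r hr hrπ => ?_
  rcases eq_or_ne r q with rfl | hrq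
  · exact ⟨R, hR, le_inf (le_inf hRE (hR.le.trans inf_le_left)) (hR.le.trans inf_le_right)⟩
  obtain ⟨W, hW⟩ := exists_isSylowIn hr (X ⊓ N)
  have hWX : W ≤ X := hW.le.trans inf_le_left
  have hWN : W ≤ N := hW.le.trans inf_le_right
  have hWπ : IsPiSubgroup π W := IsPGroup.isPiSubgroup hr hrπ hW.isPGroup
  have hZπ : IsPiSubgroup π Z := IsPGroup.isPiSubgroup hq hqπ hZ
  -- Move `W Z` into `E` by dominance in `Z X`. The image `W₁` centralizes both `Z₁` and the Sylow
  -- `q`-subgroup `Q` of `S`. A further conjugation inside `E` brings `Z` into the image of `Z₁ Q`,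
  -- so the image of `W₁` centralizes `Z` while staying in `S`.
  obtain ⟨g, hg, hle⟩ := hdom (W ⊔ Z) (sup_le (hWX.trans le_sup_right) le_sup_left)
    (hWπ.sup hZπ hWN)
  rw [← inv_inv g, ← conj_smul_le_iff, Subgroup.smul_sup] at hle
  set W₁ := MulAut.conj g⁻¹ • W with hW₁
  set Z₁ := MulAut.conj g⁻¹ • Z with hZ₁
  have hW₁S : W₁ ≤ S := le_inf (le_sup_left.trans (hle.trans inf_le_left))
    ((conj_smul_mono _ hWX).trans (Subgroup.Normal.conj_smul_eq_self g⁻¹ X).le)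
  have hZ₁E : Z₁ ≤ E := le_sup_right.trans (hle.trans inf_le_left)
  have hZ₁p : IsPGroup q Z₁ := IsPGroup.conj_smul hZ _
  have hZ₁X : Z₁ ⊔ X = G₀ := by
    rw [hZ₁, ← Subgroup.Normal.conj_smul_eq_self g⁻¹ X, ← Subgroup.smul_sup,
      Subgroup.Normal.conj_smul_eq_self]
  obtain ⟨P, hP⟩ := exists_isSylowIn hr S
  obtain ⟨Q, hQ⟩ := exists_isSylowIn hq S
  have hEP := hES.trans (hSn.normalizer_le hr hP)
  have hEQ := hES.trans (hSn.normalizer_le hq hQ)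
  have hW₁P : W₁ ≤ P := hSn.le_sylow hr hP hW₁S (IsPGroup.conj_smul hW.isPGroup _)
  have hW₁N : W₁ ≤ Subgroup.normalizer (Z₁ : Set G) := by
    rw [Subgroup.le_normalizer_iff] at hWN ⊢
    intro w hw z hz
    rw [hW₁, mem_conj_smul] at hw
    rw [hZ₁, mem_conj_smul] at hz ⊢
    have := hWN _ hw _ hz
    simpa [mul_assoc] using this
  -- Used for both `Y = Z` and `Y = Z₁`: since `E ∩ G₀ = Y S`, the index of `Y Q` there divides `|S
  -- : Q|`.
  have hcard : ∀ Y : Subgroup G, Y ≤ E → IsPGroup q Y → Y ⊔ X = G₀ →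
      IsSylowIn q (Y ⊔ Q) (E ⊓ G₀) := by
    intro Y hYE hY hYX
    refine ⟨sup_le (le_inf hYE (hYX ▸ le_sup_left))
      (le_inf (hQ.le.trans inf_le_left) (hQ.le.trans (inf_le_right.trans le_sup_right))),
      IsPGroup.to_sup_of_normal_right' hY hQ.isPGroup (hYE.trans hEQ), ?_⟩
    rw [relIndex_eq_of_factor (B := S) (le_inf inf_le_left (inf_le_right.trans le_sup_right))]
    · exact fun h => hQ.not_dvd (h.trans (Subgroup.relIndex_dvd_of_le_left _ le_sup_right))
    · intro m hm
      obtain ⟨hmE, hmG⟩ := Subgroup.mem_inf.1 hm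
      have hmY : m ∈ Y ⊔ X := hYX.symm ▸ hmG
      obtain ⟨y, hy, x, hx, rfl⟩ := exists_mul_of_mem_sup (le_normalizer_of_normal Y X) hmY
      refine ⟨y, Subgroup.mem_sup_left hy, x, Subgroup.mem_inf.2 ⟨?_, hx⟩, rfl⟩
      simpa using mul_mem (inv_mem (hYE hy)) hmE
  obtain ⟨e, he, hle₂⟩ := (hcard Z₁ hZ₁E hZ₁p hZ₁X).exists_conj hq (hcard Z hZE hZ rfl).le
    (hcard Z hZE hZ rfl).isPGroup
  have heE : e ∈ E := (Subgroup.mem_inf.1 he).1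
  have hW₁C : W₁ ≤ Subgroup.centralizer (Z₁ ⊔ Q : Subgroup G) := by
    have h1 : W₁ ≤ Subgroup.centralizer (Z₁ : Set G) :=
      commute_of_normalize hr hq hrq hZ₁p hP.isPGroup hW₁P hW₁N (hZ₁E.trans hEP)
    have h2 : W₁ ≤ Subgroup.centralizer (Q : Set G) :=
      hSn.le_centralizer hq hQ.le hQ.isPGroup hW₁S fun h =>
        hrq (IsPGroup.eq_of_prime_dvd_card hr hq (IsPGroup.conj_smul hW.isPGroup _) h).symm
    rw [Subgroup.le_centralizer_iff] at h1 h2 ⊢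
    exact sup_le h1 h2
  have hWZ : MulAut.conj e • W₁ ≤ N := by
    refine le_trans (fun w hw => ?_) (Subgroup.centralizer_le_normalizer (Z : Set G))
    refine Subgroup.mem_centralizer_iff.2 fun z hz => ?_
    rw [mem_conj_smul] at hw
    have h1 := Subgroup.mem_centralizer_iff.1 (hW₁C hw) _
      (mem_conj_smul.1 (hle₂ (Subgroup.mem_sup_left hz)))
    have h2 : e * (e⁻¹ * z * e * (e⁻¹ * w * e)) * e⁻¹ = e * (e⁻¹ * w * e * (e⁻¹ * z * e)) * e⁻¹ := by
      rw [h1]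
    simpa [mul_assoc] using h2
  refine ⟨MulAut.conj e • W₁, ?_, ?_⟩
  · refine hW.of_card_eq hr (le_inf ?_ ?_) (by rw [card_conj_smul, hW₁, card_conj_smul])
    · exact (conj_smul_mono e (hW₁S.trans inf_le_right)).trans
        (Subgroup.Normal.conj_smul_eq_self e X).le
    · exact hWZ
  · refine le_inf ?_ ?_
    · exact (conj_smul_mono e hW₁S).trans (conj_smul_of_mem_normalizer (hES heE)).le
    · exact hWZ

/-- If `U` is a Hall subgroup of `N(Z)` with largest normal `q`-subgroup `Z` and nilpotent
intersection with the normal subgroup `X`, then `Z` is a Sylow subgroup of `ZX`. -/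
lemma IsCore.isSylowIn_sup {X U Z : Subgroup G} [X.Normal] (hVn : PrimaryCommute (U ⊓ X))
    {q : ℕ} (hq : q.Prime) (hqπ : q ∈ π) (hZ : IsCore q Z U)
    (hU : IsHallIn π U (Subgroup.normalizer (Z : Set G))) (hZX : (Z ⊔ X).Normal) :
    IsSylowIn q Z (Z ⊔ X) := by
  set N := Subgroup.normalizer (Z : Set G) with hN
  have hUV : U ≤ Subgroup.normalizer ((U ⊓ X : Subgroup G) : Set G) :=
    inf_le_normalizer Subgroup.le_normalizer (le_normalizer_of_normal U X)
  obtain ⟨Q, hQ⟩ := exists_isSylowIn hq (U ⊓ X)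
  have hQZ : Q ≤ Z := hZ.max Q (hQ.le.trans inf_le_left) hQ.isPGroup
    (hUV.trans (hVn.normalizer_le hq hQ))
  -- This intersection is `Z (U ∩ X)`, and `Z` contains the Sylow subgroup `Q` of `U ∩ X`. The Hall
  -- property makes `Z` Sylow in `N ∩ Z X`, and growth of normalizers removes `N`.
  have h1 : IsSylowIn q Z (U ⊓ (N ⊓ (Z ⊔ X))) := by
    refine ⟨le_inf hZ.le (le_inf Subgroup.le_normalizer le_sup_left), hZ.isPGroup, ?_⟩
    rw [relIndex_eq_of_factor (B := U ⊓ X) (le_inf inf_le_left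
      (le_inf (inf_le_left.trans hZ.le_normalizer) (inf_le_right.trans le_sup_right)))]
    · exact fun h => hQ.not_dvd (h.trans (Subgroup.relIndex_dvd_of_le_left _ hQZ))
    · intro m hm
      obtain ⟨hmU, -, hmG⟩ := hm
      obtain ⟨z, hz, x, hx, rfl⟩ := exists_mul_of_mem_sup (le_normalizer_of_normal Z X) hmG
      refine ⟨z, hz, x, Subgroup.mem_inf.2 ⟨?_, hx⟩, rfl⟩
      simpa using mul_mem (inv_mem (hZ.le hz)) hmU
  have h2 : IsHallIn π (U ⊓ (N ⊓ (Z ⊔ X))) (N ⊓ (Z ⊔ X)) :=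
    hU.inf inf_le_left (inf_le_normalizer (hU.le.trans Subgroup.le_normalizer)
      (le_normalizer_of_normal U _))
  have h3 := h2.sylow hq hqπ h1
  obtain ⟨P, hP, hZP⟩ := exists_isSylowIn_ge hq (le_sup_left : Z ≤ Z ⊔ X) hZ.isPGroup
  rcases hZP.eq_or_lt with rfl | hlt
  · exact hP
  · refine absurd (lt_inf_normalizer hq hP.isPGroup hlt) ?_
    have := h3.eq_of_le hq (le_inf hZP Subgroup.le_normalizer : Z ≤ P ⊓ N)
      (le_inf inf_le_right (inf_le_left.trans hP.le)) (hP.isPGroup.to_le inf_le_left)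
    exact this.not_lt

/-- The Frattini argument in a Hall subgroup. -/
lemma exists_mul_of_isSylowIn_sup {X E Z : Subgroup G} [X.Normal] (hEX : E ⊔ X = ⊤) {q : ℕ}
    (hq : q.Prime) (hZE : Z ≤ E) (hZX : (Z ⊔ X).Normal) (hZ : IsSylowIn q Z (Z ⊔ X)) (g : G) :
    ∃ n ∈ E ⊓ Subgroup.normalizer (Z : Set G), ∃ x ∈ X, g = n * x := by
  obtain ⟨e, he, x, hx, rfl⟩ := exists_mul_of_sup_eq_top hEX g
  have hE₀ : E ≤ Subgroup.normalizer ((E ⊓ (Z ⊔ X) : Subgroup G) : Set G) :=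
    inf_le_normalizer Subgroup.le_normalizer (le_normalizer_of_normal E _)
  have hZ₀ : IsSylowIn q Z (E ⊓ (Z ⊔ X)) := hZ.mono (le_inf hZE le_sup_left) inf_le_right
  obtain ⟨k, hk, hle⟩ := hZ₀.exists_conj hq (Q := MulAut.conj e • Z)
    ((conj_smul_mono e hZ₀.le).trans (conj_smul_of_mem_normalizer (hE₀ he)).le)
    (IsPGroup.conj_smul hZ.isPGroup e)
  rw [Subgroup.mem_inf] at hk
  have h1 : k⁻¹ * e ∈ Subgroup.normalizer (Z : Set G) := by
    refine mem_normalizer_of_conj_smul_le ?_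
    rw [conj_smul_mul, conj_smul_le_iff, inv_inv]
    exact hle
  -- With `k = z y`, multiplying `k⁻¹ e` on the left by `z` keeps it in `N_E(Z)` and makes it
  -- congruent to `e` modulo `X`.
  obtain ⟨z, hz, y, hy, rfl⟩ := exists_mul_of_mem_sup (le_normalizer_of_normal Z X) hk.2
  refine ⟨z * ((z * y)⁻¹ * e), mul_mem (Subgroup.mem_inf.2 ⟨hZE hz, Subgroup.le_normalizer hz⟩)
    (Subgroup.mem_inf.2 ⟨mul_mem (inv_mem hk.1) he, h1⟩), e⁻¹ * (z * y * z⁻¹) * e * x,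
    mul_mem ?_ hx, by group⟩
  have h2 := Subgroup.Normal.conj_mem (inferInstance : X.Normal) y hy (e⁻¹ * z)
  simpa [mul_assoc] using h2

end HallNormalizer

/-! ### P. Hall's dominance theorem for nilpotent-by-soluble configurations. -/

section Dominance

variable {G : Type*} [Group G] {π : Set ℕ}

/-- `X` is normal with a nilpotent Hall `π`-subgroup and `G / X` is a soluble `π`-group. -/
structure IsNilpotentBySoluble (π : Set ℕ) (X : Subgroup G) : Prop where
  normal : X.Normal
  exists_hall : ∃ S, IsHallIn π S X ∧ PrimaryCommute S
  derivedSeries_le : ∃ d, derivedSeries G d ≤ X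
  index : IsPiNumber π X.index

lemma IsNilpotentBySoluble.subgroupOf {X : Subgroup G} (h : IsNilpotentBySoluble π X)
    {N S : Subgroup G} (hS : IsHallIn π S (X ⊓ N)) (hSn : PrimaryCommute S) :
    IsNilpotentBySoluble π (X.subgroupOf N) := by
  have := h.normal
  refine ⟨inferInstance, ⟨S.subgroupOf N, ⟨?_, ?_, ?_⟩,
    hSn.comap N.subtype N.subtype_injective⟩, ?_, ?_⟩
  · exact Subgroup.comap_mono (hS.le.trans inf_le_left)
  · rw [IsPiSubgroup,
      Nat.card_congr (Subgroup.subgroupOfEquivOfLe (hS.le.trans inf_le_right)).toEquiv]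
    exact hS.2
  · rw [← Subgroup.inf_subgroupOf_right X N, Subgroup.relIndex_subgroupOf inf_le_right]
    exact hS.3
  · obtain ⟨d, hd⟩ := h.derivedSeries_le
    exact ⟨d, Subgroup.map_le_iff_le_comap.1
      ((map_derivedSeries_le_derivedSeries N.subtype d).trans hd)⟩
  · exact h.index.of_dvd (Subgroup.relIndex_dvd_index_of_normal X N)

lemma IsPiSubgroup.map {U : Subgroup G} (hU : IsPiSubgroup π U) {H : Type*} [Group H]
    (f : G →* H) : IsPiSubgroup π (U.map f) :=
  IsPiNumber.of_dvd hU (Subgroup.card_map_dvd U f)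

lemma IsHall.map {E : Subgroup G} (hE : IsHall π E) {H : Type*} [Group H]
    {f : G →* H} (hf : Function.Surjective f) : IsHall π (E.map f) :=
  ⟨hE.1.map f, hE.2.of_dvd (Subgroup.index_map_dvd E hf)⟩

lemma map_conj_smul (g : G) (E : Subgroup G) {H : Type*} [Group H] (f : G →* H) :
    (MulAut.conj g • E).map f = MulAut.conj (f g) • E.map f := by
  ext y
  simp only [Subgroup.mem_map, mem_conj_smul]
  constructor
  · rintro ⟨x, hx, rfl⟩
    exact ⟨_, hx, by simp⟩
  · rintro ⟨x, hx, h⟩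
    exact ⟨g * x * g⁻¹, by simpa [mul_assoc] using hx, by simp [h, mul_assoc]⟩

lemma IsNilpotentBySoluble.map [Finite G] {X : Subgroup G} (h : IsNilpotentBySoluble π X)
    {H : Type*} [Group H] [Finite H] {f : G →* H} (hf : Function.Surjective f) :
    IsNilpotentBySoluble π (X.map f) := by
  refine ⟨h.normal.map f hf, ?_, ?_, h.index.of_dvd (Subgroup.index_map_dvd X hf)⟩
  · obtain ⟨S, hS, hSn⟩ := h.exists_hall
    refine ⟨S.map f, ⟨Subgroup.map_mono hS.le, hS.2.map f, ?_⟩, hSn.map_of_hom f⟩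
    rw [Subgroup.relIndex_map_map]
    have hk : ∀ m ∈ X ⊔ f.ker, ∃ a ∈ S ⊔ f.ker, ∃ b ∈ X, m = a * b := fun m hm => by
      obtain ⟨k, hk, x, hx, rfl⟩ := exists_mul_of_mem_sup_right (le_normalizer_of_normal X f.ker) hm
      exact ⟨k, Subgroup.mem_sup_right hk, x, hx, rfl⟩
    rw [relIndex_eq_of_factor le_sup_left hk]
    exact hS.3.of_dvd (Subgroup.relIndex_dvd_of_le_left _ le_sup_left)
  · obtain ⟨d, hd⟩ := h.derivedSeries_le
    exact ⟨d, (map_derivedSeries_eq hf d).ge.trans (Subgroup.map_mono hd)⟩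

lemma IsHall.conj_smul {E : Subgroup G} (hE : IsHall π E) (g : G) :
    IsHall π (MulAut.conj g • E) :=
  ⟨hE.1.conj_smul g, by rw [index_conj_smul]; exact hE.2⟩

/-- Dominance and conjugacy for Hall subgroups can be transferred from the type `↥N`. -/
lemma exists_conj_of_subgroupOf {N : Subgroup G}
    (h : ∀ E U : Subgroup N, IsHall π E → IsPiSubgroup π U → ∃ g : N, U ≤ MulAut.conj g • E)
    {E U : Subgroup G} (hE : IsHallIn π E N) (hUN : U ≤ N) (hU : IsPiSubgroup π U) :
    ∃ g ∈ N, U ≤ MulAut.conj g • E := by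
  obtain ⟨g, hg⟩ := h (E.subgroupOf N) (U.subgroupOf N) ((isHall_subgroupOf hE.le).2 hE) (by
    rwa [IsPiSubgroup, Nat.card_congr (Subgroup.subgroupOfEquivOfLe hUN).toEquiv])
  refine ⟨g, g.2, fun x hx => ?_⟩
  have := hg (Subgroup.mem_subgroupOf.2 hx : (⟨x, hUN hx⟩ : N) ∈ U.subgroupOf N)
  rw [mem_conj_smul] at this ⊢
  exact this

variable [Finite G]

lemma IsHall.exists_conj_of_isPGroup {p : ℕ} (hp : p.Prime) (hpπ : p ∈ π) {E P : Subgroup G}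
    (hE : IsHall π E) (hP : IsPGroup p P) : ∃ g : G, P ≤ MulAut.conj g • E := by
  obtain ⟨g, -, hg⟩ := (isHallIn_top.2 hE).exists_conj_of_isPGroup hp hpπ le_top hP
  exact ⟨g, hg⟩

/-- The inductive step when the core `Z` is normal. -/
lemma exists_conj_of_quotient {E U Z : Subgroup G} [Z.Normal] (hE : IsHall π E)
    (hU : IsPiSubgroup π U) {q : ℕ} (hq : q.Prime) (hqπ : q ∈ π) (hZ : IsPGroup q Z)
    (h : ∀ E U : Subgroup (G ⧸ Z), IsHall π E → IsPiSubgroup π U →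
      ∃ g : G ⧸ Z, U ≤ MulAut.conj g • E) : ∃ g : G, U ≤ MulAut.conj g • E := by
  have hf := QuotientGroup.mk'_surjective Z
  obtain ⟨g, hg⟩ := h _ _ (hE.map hf) (hU.map (QuotientGroup.mk' Z))
  obtain ⟨g, rfl⟩ := hf g
  refine ⟨g, ?_⟩
  rw [← map_conj_smul, Subgroup.map_le_iff_le_comap, Subgroup.comap_map_eq,
    QuotientGroup.ker_mk'] at hg
  refine hg.trans (sup_le le_rfl ?_)
  obtain ⟨k, hk⟩ := hE.exists_conj_of_isPGroup hq hqπ hZ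
  rw [← Subgroup.Normal.conj_smul_eq_self k Z] at hk
  rw [← Subgroup.Normal.conj_smul_eq_self g Z]
  exact conj_smul_mono g (Subgroup.pointwise_smul_le_pointwise_smul_iff.1 hk)

/-- P. Hall's theorem: if `X` is normal with a nilpotent Hall `π`-subgroup and `G / X` is a soluble
`π`-group, then every `π`-subgroup lies in a conjugate of every Hall `π`-subgroup. -/
theorem IsNilpotentBySoluble.exists_conj {G : Type*} [Group G] [Finite G] {X : Subgroup G}
    (hX : IsNilpotentBySoluble π X) {E U : Subgroup G} (hE : IsHall π E)
    (hU : IsPiSubgroup π U) : ∃ g : G, U ≤ MulAut.conj g • E := by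
  induction hn : Nat.card G using Nat.strong_induction_on generalizing G with
  | _ n ih =>
  subst hn
  have hXn := hX.normal
  obtain ⟨S, hS, hSn⟩ := hX.exists_hall
  obtain ⟨d, hd⟩ := hX.derivedSeries_le
  have hdom : ∀ (N : Subgroup G) (T : Subgroup G), N ≠ ⊤ → IsHallIn π T (X ⊓ N) →
      PrimaryCommute T → ∀ F W : Subgroup G, IsHallIn π F N → W ≤ N → IsPiSubgroup π W →
      ∃ g ∈ N, W ≤ MulAut.conj g • F := by
    intro N T hN hT hTn F W hF hWN hW
    have hcard : Nat.card N < Nat.card G :=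
      lt_of_le_of_ne (Subgroup.card_le_card_group N) fun h => hN (Subgroup.eq_top_of_card_eq N h)
    exact exists_conj_of_subgroupOf
      (fun E U hE hU => ih _ hcard (hX.subgroupOf hT hTn) hE hU rfl) hF hWN hW
  -- Maximality is what later forces `M` to be a full Hall subgroup of the normalizer of its core.
  obtain ⟨M, hUM, hM, hMmax⟩ : ∃ M : Subgroup G, U ≤ M ∧ IsPiSubgroup π M ∧
      ∀ V : Subgroup G, M ≤ V → IsPiSubgroup π V → M = V := by
    let I := {V : Subgroup G // U ≤ V ∧ IsPiSubgroup π V}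
    have : Nonempty I := ⟨⟨U, le_rfl, hU⟩⟩
    obtain ⟨⟨M, hUM, hM⟩, hmax⟩ := Finite.exists_max (fun V : I => Nat.card V.1)
    exact ⟨M, hUM, hM, fun V hMV hV =>
      Subgroup.eq_of_le_of_card_ge hMV (hmax ⟨V, hUM.trans hMV, hV⟩)⟩
  suffices h : ∃ g : G, M ≤ MulAut.conj g • E from h.imp fun g hg => hUM.trans hg
  clear hUM hU U
  by_cases hXtop : X = ⊤
  · subst hXtop
    obtain ⟨k, -, hk⟩ := hS.exists_conj_of_primaryCommute hSn le_top hM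
    obtain ⟨l, -, hl⟩ := hS.exists_eq_conj_of_primaryCommute hSn (isHallIn_top.2 hE)
    exact ⟨k * l⁻¹, by rwa [hl, ← conj_smul_mul, inv_mul_cancel_right]⟩
  have hEX : E ⊔ X = ⊤ := isHall_sup_eq_top hE hX.index
  by_cases hMX : M ⊔ X = ⊤
  swap
  -- If `M X` is proper, `E ∩ M X` is a Hall subgroup of it, and the induction hypothesis places `M`
  -- in a conjugate.
  · have hXG : X ⊓ (M ⊔ X) = X := inf_eq_left.2 le_sup_right
    have hF : IsHallIn π (E ⊓ (M ⊔ X)) (M ⊔ X) := by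
      refine ⟨inf_le_right, hE.1.mono inf_le_left, hE.2.of_dvd ?_⟩
      rw [Subgroup.inf_relIndex_right, ← Subgroup.relIndex_top_right,
        relIndex_eq_of_factor (A := E) (M := ⊤) (B := M ⊔ X) le_top fun g _ => ?_]
      obtain ⟨e, he, x, hx, rfl⟩ := exists_mul_of_sup_eq_top hEX g
      exact ⟨e, he, x, Subgroup.mem_sup_right hx, rfl⟩
    obtain ⟨g, -, hg⟩ := hdom (M ⊔ X) S hMX (hXG.symm ▸ hS) hSn _ M hF le_sup_left hM
    exact ⟨g, hg.trans (conj_smul_mono g inf_le_left)⟩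
  have hVn : PrimaryCommute (M ⊓ X) := by
    obtain ⟨k, -, hk⟩ := hS.exists_conj_of_primaryCommute hSn inf_le_right
      (hM.mono (inf_le_left : M ⊓ X ≤ M))
    exact (hSn.conj_smul k).mono hk
  have hmem : ∀ p, p.Prime → ∀ Z : Subgroup G, Z ≤ M → IsPGroup p Z → Z ≠ ⊥ → p ∈ π := by
    intro p hp Z hZM hZ hne
    have := Fact.mk hp
    refine isPiNumber_iff.1 hM p hp (dvd_trans ?_ (Subgroup.card_dvd_of_le hZM))
    exact hZ.card_eq_or_dvd.resolve_left fun h => hne (Subgroup.card_eq_one.1 h)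
  rcases exists_core_sup_ne_top hXtop hd hVn with ⟨p, hp, hMp⟩ | ⟨q, hq, Z, hZ, hZne, hZX⟩
  · by_cases hMbot : M = ⊥
    · exact ⟨1, hMbot ▸ bot_le⟩
    · exact hE.exists_conj_of_isPGroup hp (hmem p hp M le_rfl hMp hMbot) hMp
  have hqπ := hmem q hq Z hZ.le hZ.isPGroup hZne
  set N := Subgroup.normalizer (Z : Set G) with hN
  by_cases hNtop : N = ⊤
  · have hZn : Z.Normal := Subgroup.normalizer_eq_top_iff.1 hNtop
    refine exists_conj_of_quotient hE hM hq hqπ hZ.isPGroup fun E' U' hE' hU' => ?_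
    refine ih _ ?_ (hX.map (QuotientGroup.mk'_surjective Z)) hE' hU' rfl
    rw [Subgroup.card_eq_card_quotient_mul_card_subgroup Z]
    exact lt_mul_of_one_lt_right Nat.card_pos ((Subgroup.one_lt_card_iff_ne_bot Z).2 hZne)
  have hG₀n : (Z ⊔ X).Normal := by
    rw [← Subgroup.normalizer_eq_top_iff, eq_top_iff, ← hMX]
    exact sup_le ((le_inf hZ.le_normalizer (le_normalizer_of_normal M X)).trans
      (Subgroup.normalizer_inf_normalizer_le_normalizer_sup Z X))
      (le_sup_right.trans Subgroup.le_normalizer)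
  obtain ⟨R, hR⟩ := exists_isSylowIn hq (X ⊓ N)
  -- `R` normalizes `Z`, so `R Z` is a `q`-group and one conjugate `F` of `E` contains both, as
  -- `isHallIn_inf_normalizer` requires.
  obtain ⟨g₀, hg₀⟩ := hE.exists_conj_of_isPGroup hq hqπ (P := R ⊔ Z)
    (IsPGroup.to_sup_of_normal_right' hR.isPGroup hZ.isPGroup (hR.le.trans inf_le_right))
  set F := MulAut.conj g₀ • E with hF
  have hFH : IsHall π F := hE.conj_smul g₀
  have hFX : F ⊔ X = ⊤ := isHall_sup_eq_top hFH hX.index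
  have hZF : Z ≤ F := le_sup_right.trans hg₀
  have hinf : ∀ K : Subgroup G, K.Normal → IsHallIn π (F ⊓ K) K := fun K hK =>
    (isHallIn_top.2 hFH).inf le_top (le_normalizer_of_normal F K)
  have hSn' : PrimaryCommute (F ⊓ X) := by
    obtain ⟨k, -, hk⟩ := hS.exists_eq_conj_of_primaryCommute hSn (hinf X hXn)
    exact hk ▸ hSn.conj_smul k
  have hSX : X ⊓ (Z ⊔ X) = X := inf_eq_left.2 le_sup_right
  have hSN : IsHallIn π (F ⊓ X ⊓ N) (X ⊓ N) :=
    isHallIn_inf_normalizer hFH hSn' hq hqπ hZ.isPGroup hZF hG₀n hR (le_sup_left.trans hg₀)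
      fun W hW hWπ => hdom (Z ⊔ X) S hZX (hSX.symm ▸ hS) hSn _ W (hinf _ hG₀n) hW hWπ
  have hSNn : PrimaryCommute (F ⊓ X ⊓ N) := hSn'.mono inf_le_left
  have hdomN := hdom N _ hNtop hSN hSNn
  have hMN : IsHallIn π M N := by
    have hex : ∃ H : Subgroup N, IsHall π H := by
      have hXN := hX.subgroupOf hSN hSNn
      obtain ⟨S', hS', hSn''⟩ := hXN.exists_hall
      have := hXN.normal
      exact exists_isHall_of_normal hS' hSn'' hXN.index
    obtain ⟨H, hH⟩ := hex
    have hH' : IsHallIn π (H.map N.subtype) N := by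
      rw [← isHall_subgroupOf (Subgroup.map_subtype_le H), Subgroup.subgroupOf,
        Subgroup.comap_map_eq_self_of_injective N.subtype_injective]
      exact hH
    obtain ⟨k, hk, hle⟩ := hdomN _ M hH' hZ.le_normalizer hM
    have hH'' := hH'.conj_smul (Subgroup.le_normalizer hk)
    rw [hMmax _ hle hH''.2]
    exact hH''
  have hZsyl := hZ.isSylowIn_sup hVn hq hqπ hMN hG₀n
  have hfac := exists_mul_of_isSylowIn_sup hFX hq hZF hG₀n hZsyl
  -- The Frattini factorization `G = (F ∩ N) X` reduces this index to one inside `X ∩ N`, where `F ∩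
  -- X ∩ N` is already Hall. Dominance in `N` then finishes.
  have hFN : IsHallIn π (F ⊓ N) N := by
    refine ⟨inf_le_right, hFH.1.mono inf_le_left, ?_⟩
    rw [relIndex_eq_of_factor (B := X ⊓ N) inf_le_right fun m hm => ?_]
    · refine hSN.3.of_dvd (Subgroup.relIndex_dvd_of_le_left _ ?_)
      exact inf_le_inf_right N inf_le_left
    · obtain ⟨a, ha, x, hx, rfl⟩ := hfac m
      refine ⟨a, ha, x, Subgroup.mem_inf.2 ⟨hx, ?_⟩, rfl⟩
      simpa using mul_mem (inv_mem (Subgroup.mem_inf.1 ha).2) hm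
  obtain ⟨k, -, hk⟩ := hdomN _ M hFN hZ.le_normalizer hM
  exact ⟨k * g₀, by
    rw [conj_smul_mul]
    exact hk.trans (conj_smul_mono k inf_le_left)⟩

end Dominance

/-! ### Extensions and normal series. -/

section Extension

variable {G : Type*} [Group G] {π : Set ℕ}

/-- `G` has a soluble Hall `π`-subgroup a conjugate of which contains any given `π`-subgroup. -/
def HasDominantSolubleHall (π : Set ℕ) (G : Type*) [Group G] : Prop :=
  ∃ E : Subgroup G, IsHall π E ∧ Group.IsSolvable E ∧
    ∀ U : Subgroup G, IsPiSubgroup π U → ∃ g : G, U ≤ MulAut.conj g • E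

variable [Finite G]

lemma HasDominantSolubleHall.isDS (h : HasDominantSolubleHall π G) : IsDS π G := by
  obtain ⟨E, hE, hEs, hdom⟩ := h
  have hconj : ∀ H : Subgroup G, IsHall π H → ∃ g : G, H = MulAut.conj g • E := by
    intro H hH
    obtain ⟨g, hg⟩ := hdom H hH.1
    exact ⟨g, (isHallIn_top.2 hH).eq_of_le hg le_top (hE.1.conj_smul g)⟩
  refine ⟨⟨⟨E, hE, hEs⟩, ⟨E, hE⟩, fun H K hH hK => ?_⟩, fun U hU => ?_⟩
  · obtain ⟨g, rfl⟩ := hconj H hH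
    obtain ⟨k, rfl⟩ := hconj K hK
    refine ⟨g * k⁻¹, ?_⟩
    rw [conj, ← conj_smul_mul]
    group
  · obtain ⟨g, hg⟩ := hdom U hU
    exact ⟨_, hE.conj_smul g, hg⟩

/-- P. Hall: an extension of a group with a nilpotent Hall `π`-subgroup by a `D^S_π`-group is a
`D^S_π`-group. -/
theorem HasDominantSolubleHall.of_surjective {Q : Type*} [Group Q]
    (hQ : HasDominantSolubleHall π Q) {f : G →* Q} (hf : Function.Surjective f)
    {S : Subgroup G} (hS : IsHallIn π S f.ker) (hSn : PrimaryCommute S) :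
    HasDominantSolubleHall π G := by
  obtain ⟨E₀, hE₀, hE₀s, hdom⟩ := hQ
  -- `|G : L|` is a `π'`-number, so a Hall subgroup of `L` is one of `G`. Any `π`-subgroup is
  -- conjugated first into `L`, by dominance in `Q`, and then into `E`, by dominance in `L`.
  set L := E₀.comap f with hL
  have hkL : f.ker ≤ L := Subgroup.ker_le_comap f E₀
  have hNS : IsNilpotentBySoluble π (f.ker.subgroupOf L) := by
    refine ⟨inferInstance, ⟨S.subgroupOf L, ⟨Subgroup.comap_mono hS.le, ?_, ?_⟩,
      hSn.comap L.subtype L.subtype_injective⟩, ?_, ?_⟩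
    · rw [IsPiSubgroup, Nat.card_congr (Subgroup.subgroupOfEquivOfLe (hS.le.trans hkL)).toEquiv]
      exact hS.2
    · rw [Subgroup.relIndex_subgroupOf hkL]
      exact hS.3
    · obtain ⟨d, hd⟩ := (Group.isSolvable_def E₀).1 hE₀s
      refine ⟨d, fun x hx => ?_⟩
      have h1 := map_derivedSeries_le_derivedSeries (f.subgroupComap E₀) d
        (Subgroup.mem_map_of_mem _ hx)
      rw [hd, Subgroup.mem_bot] at h1
      rw [Subgroup.mem_subgroupOf, MonoidHom.mem_ker]
      exact congrArg Subtype.val h1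
    · rw [← Subgroup.relIndex, Subgroup.relIndex_ker, hL,
        Subgroup.map_comap_eq_self_of_surjective hf]
      exact hE₀.1
  obtain ⟨E', hE'⟩ : ∃ E' : Subgroup L, IsHall π E' := by
    obtain ⟨T, hT, hTn⟩ := hNS.exists_hall
    exact exists_isHall_of_normal hT hTn hNS.index
  set E := E'.map L.subtype with hE
  have hEL : E ≤ L := Subgroup.map_subtype_le E'
  have hEH : IsHallIn π E L := by
    rw [← isHall_subgroupOf hEL, hE, Subgroup.subgroupOf,
      Subgroup.comap_map_eq_self_of_injective L.subtype_injective]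
    exact hE'
  refine ⟨E, ⟨hEH.2, ?_⟩, ?_, fun U hU => ?_⟩
  · rw [← Subgroup.relIndex_mul_index hEL, hL, Subgroup.index_comap_of_surjective _ hf]
    exact hEH.3.mul hE₀.2
  · have hVn : PrimaryCommute (E ⊓ f.ker) := by
      obtain ⟨k, -, hk⟩ := hS.exists_conj_of_primaryCommute hSn inf_le_right
        (hEH.2.mono (inf_le_left : E ⊓ f.ker ≤ E))
      exact (hSn.conj_smul k).mono hk
    have hVs := isNilpotent_iff_primaryCommute.2 hVn
    refine Group.isSolvable_of_ker_le_range (Subgroup.inclusion (inf_le_left : E ⊓ f.ker ≤ E))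
      ((f.subgroupComap E₀).comp (Subgroup.inclusion hEL)) fun x hx => ?_
    refine ⟨⟨x, x.2, ?_⟩, rfl⟩
    exact congrArg Subtype.val (MonoidHom.mem_ker.1 hx)
  · obtain ⟨g', hg'⟩ := hdom _ (hU.map f)
    obtain ⟨g, rfl⟩ := hf g'
    have hUL : MulAut.conj g⁻¹ • U ≤ L := by
      rw [conj_smul_le_iff, inv_inv]
      intro x hx
      have h1 := hg' (Subgroup.mem_map_of_mem f hx)
      rw [mem_conj_smul] at h1 ⊢
      simpa [hL] using h1
    obtain ⟨k, -, hk⟩ := exists_conj_of_subgroupOf (fun E U hE hU => hNS.exists_conj hE hU) hEH hUL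
      (hU.conj_smul g⁻¹)
    rw [conj_smul_le_iff, inv_inv, ← conj_smul_mul] at hk
    exact ⟨_, hk⟩

lemma exists_isHallIn_of_atMostOnePrime {K : Subgroup G} (hK : AtMostOnePrime π (Nat.card K)) :
    ∃ S, IsHallIn π S K ∧ PrimaryCommute S := by
  by_cases h : ∃ p, p.Prime ∧ p ∈ π ∧ p ∣ Nat.card K
  · obtain ⟨p, hp, hpπ, hpK⟩ := h
    have := Fact.mk hp
    obtain ⟨P, hP⟩ := exists_isSylowIn hp K
    refine ⟨P, ⟨hP.le, IsPGroup.isPiSubgroup hp hpπ hP.isPGroup,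
      isPiNumber_compl_iff.2 fun q hq hqπ hqP => hP.not_dvd ?_⟩,
      isNilpotent_iff_primaryCommute.1 hP.isPGroup.isNilpotent⟩
    rwa [hK p q hp hq hpπ hqπ hpK (hqP.trans (Subgroup.relIndex_dvd_card _ _))]
  · push Not at h
    refine ⟨⊥, ⟨bot_le, ?_, isPiNumber_compl_iff.2 fun p hp hpπ => ?_⟩, ?_⟩
    · simp [IsPiSubgroup, IsPiNumber]
    · rw [Subgroup.relIndex_bot_left]
      exact h p hp hpπ
    · exact isNilpotent_iff_primaryCommute.1 inferInstance

lemma hasDominantSolubleHall_of_subsingleton [Subsingleton G] : HasDominantSolubleHall π G :=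
  ⟨⊤, ⟨by simp [IsPiSubgroup, IsPiNumber], by simp [IsPiNumber]⟩, inferInstance,
    fun U _ => ⟨1, fun x _ => by rw [mem_conj_smul]; exact Subgroup.mem_top _⟩⟩

/-- A group with a normal series whose bottom term has a nilpotent Hall `π`-subgroup and whose other
factors have orders divisible by at most one prime of `π` is a `D^S_π`-group. -/
theorem hasDominantSolubleHall_of_series {M : ℕ → Subgroup G} (hM : ∀ j, (M j).Normal)
    (h0 : M 0 = ⊤) {t : ℕ} (hanti : ∀ j < t, M (j + 1) ≤ M j)
    (hone : ∀ j < t, AtMostOnePrime π ((M (j + 1)).relIndex (M j)))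
    {S : Subgroup G} (hS : IsHallIn π S (M t)) (hSn : PrimaryCommute S) :
    HasDominantSolubleHall π G := by
  have key : ∀ j ≤ t, HasDominantSolubleHall π (G ⧸ M j) := by
    intro j
    induction j with
    | zero =>
      intro _
      have : Subsingleton (G ⧸ M 0) := QuotientGroup.subsingleton_iff.2 h0
      exact hasDominantSolubleHall_of_subsingleton
    | succ j ih =>
      intro hj
      let f : G ⧸ M (j + 1) →* G ⧸ M j := QuotientGroup.map _ _ (MonoidHom.id G) (hanti j hj)
      have hf : Function.Surjective f := by
        intro y
        obtain ⟨g, rfl⟩ := QuotientGroup.mk'_surjective _ y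
        exact ⟨(g : G ⧸ M (j + 1)), rfl⟩
      have hker : f.ker = (M j).map (QuotientGroup.mk' (M (j + 1))) := by
        ext y
        obtain ⟨g, rfl⟩ := QuotientGroup.mk'_surjective _ y
        have hg : f (QuotientGroup.mk' _ g) = 1 ↔ g ∈ M j := QuotientGroup.eq_one_iff g
        rw [MonoidHom.mem_ker, hg]
        refine ⟨fun h => ⟨g, h, rfl⟩, ?_⟩
        rintro ⟨h, hh, hhg⟩
        have := mul_mem hh (hanti j hj (QuotientGroup.eq.1 hhg))
        rwa [mul_inv_cancel_left] at this
      obtain ⟨T, hT, hTn⟩ := exists_isHallIn_of_atMostOnePrime (K := f.ker) (π := π) (by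
        rw [hker, ← Subgroup.relIndex_ker, QuotientGroup.ker_mk']
        exact hone j hj)
      exact (ih (by omega)).of_surjective hf hT hTn
  refine (key t le_rfl).of_surjective (QuotientGroup.mk'_surjective (M t)) (S := S) ?_ hSn
  rwa [QuotientGroup.ker_mk']

end Extension

/-! ### Permutability with cyclic primary subgroups, and the descending series. -/

section Permutability

variable {G : Type*} [Group G] {π : Set ℕ}

/-- `B A ⊆ A B`. -/
def MulSwaps (A B : Subgroup G) : Prop :=
  ∀ b ∈ B, ∀ a ∈ A, ∃ a' ∈ A, ∃ b' ∈ B, b * a = a' * b'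

lemma Permutes.mulSwaps {A B : Subgroup G} (h : Permutes A B) : MulSwaps A B := by
  intro b hb a ha
  have h1 : b * a ∈ (A : Set G) * (B : Set G) := h ▸ Set.mul_mem_mul hb ha
  obtain ⟨a', ha', b', hb', h2⟩ := h1
  exact ⟨a', ha', b', hb', h2.symm⟩

lemma MulSwaps.sup_normal {A B : Subgroup G} (h : MulSwaps A B) (X : Subgroup G) [X.Normal] :
    MulSwaps (A ⊔ X) B := by
  intro b hb c hc
  obtain ⟨x, hx, a, ha, rfl⟩ := exists_mul_of_mem_sup_right (le_normalizer_of_normal A X) hc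
  obtain ⟨a', ha', b', hb', hab⟩ := h b hb a ha
  refine ⟨b * x * b⁻¹ * a', mul_mem (Subgroup.mem_sup_right ?_) (Subgroup.mem_sup_left ha'),
    b', hb', ?_⟩
  · exact Subgroup.Normal.conj_mem inferInstance x hx b
  · rw [mul_assoc _ a' b', ← hab]
    group

lemma MulSwaps.conj_smul {A B : Subgroup G} (h : MulSwaps A B) {c : G} (hc : c ∈ A) :
    MulSwaps A (MulAut.conj c • B) := by
  intro b hb a ha
  rw [mem_conj_smul] at hb
  obtain ⟨a', ha', b', hb', hab⟩ := h _ hb (c⁻¹ * a * c) (mul_mem (mul_mem (inv_mem hc) ha) hc)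
  refine ⟨c * a' * c⁻¹, mul_mem (mul_mem hc ha') (inv_mem hc), c * b' * c⁻¹,
    conj_mem_conj_smul hb', ?_⟩
  calc b * a = c * (c⁻¹ * b * c * (c⁻¹ * a * c)) * c⁻¹ := by group
    _ = c * (a' * b') * c⁻¹ := by rw [hab]
    _ = _ := by group

lemma MulSwaps.exists_mul {A B : Subgroup G} (h : MulSwaps A B) {m : G} (hm : m ∈ A ⊔ B) :
    ∃ a ∈ A, ∃ b ∈ B, m = a * b := by
  let J : Subgroup G :=
    { carrier := {m | ∃ a ∈ A, ∃ b ∈ B, m = a * b}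
      one_mem' := ⟨1, one_mem A, 1, one_mem B, (one_mul 1).symm⟩
      mul_mem' := by
        rintro _ _ ⟨a, ha, b, hb, rfl⟩ ⟨c, hc, d, hd, rfl⟩
        obtain ⟨c', hc', b', hb', hbc⟩ := h b hb c hc
        refine ⟨a * c', mul_mem ha hc', b' * d, mul_mem hb' hd, ?_⟩
        rw [mul_assoc a, ← mul_assoc b, hbc]
        group
      inv_mem' := by
        rintro _ ⟨a, ha, b, hb, rfl⟩
        rw [mul_inv_rev]
        exact h _ (inv_mem hb) _ (inv_mem ha) }
  have hJ : A ⊔ B ≤ J := sup_le (fun a ha => ⟨a, ha, 1, one_mem B, (mul_one a).symm⟩)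
    fun b hb => ⟨1, one_mem A, b, hb, (one_mul b).symm⟩
  exact hJ hm

lemma relIndex_sup_dvd (A B X : Subgroup G) [X.Normal] :
    (A ⊔ X).relIndex (B ⊔ X) ∣ A.relIndex B := by
  have h : ∀ m ∈ B ⊔ X, ∃ a ∈ A ⊔ X, ∃ b ∈ B, m = a * b := fun m hm => by
    obtain ⟨x, hx, b, hb, rfl⟩ := exists_mul_of_mem_sup_right (le_normalizer_of_normal B X) hm
    exact ⟨x, Subgroup.mem_sup_right hx, b, hb, rfl⟩
  rw [relIndex_eq_of_factor le_sup_left h]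
  exact Subgroup.relIndex_dvd_of_le_left _ le_sup_left

/-- Starting from the whole group, repeatedly pass to the subgroup generated by `X` and the
`q`-elements, for the primes `q ∈ π` not dividing the current entry of `r`. -/
def primarySeries (π : Set ℕ) (X : Subgroup G) (r : ℕ → ℕ) : ℕ → Subgroup G
  | 0 => ⊤
  | j + 1 => X ⊔ Subgroup.closure {g | g ∈ primarySeries π X r j ∧
      ∃ q ∈ π, q.Prime ∧ ¬ q ∣ r j ∧ IsPrimaryElt q g}

lemma le_primarySeries (X : Subgroup G) (r : ℕ → ℕ) : ∀ j, X ≤ primarySeries π X r j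
  | 0 => le_top
  | _ + 1 => le_sup_left

lemma primarySeries_succ_le (X : Subgroup G) (r : ℕ → ℕ) (j : ℕ) :
    primarySeries π X r (j + 1) ≤ primarySeries π X r j :=
  sup_le (le_primarySeries X r j) ((Subgroup.closure_le _).2 fun _ hg => hg.1)

lemma primarySeries_normal (X : Subgroup G) [X.Normal] (r : ℕ → ℕ) (j : ℕ) :
    (primarySeries π X r j).Normal := by
  induction j with
  | zero => exact inferInstanceAs (⊤ : Subgroup G).Normal
  | succ j ih =>
    rw [primarySeries]
    refine @Subgroup.sup_normal _ _ _ _ inferInstance ?_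
    rw [← Subgroup.normalizer_eq_top_iff, eq_top_iff, Subgroup.le_normalizer_closure_iff]
    rintro h - g ⟨hg, q, hqπ, hq, hqr, hgq⟩
    exact Subgroup.subset_closure ⟨ih.conj_mem g hg h, q, hqπ, hq, hqr, hgq.conj h⟩

variable [Finite G]

/-- A `q`-element permuting with `A` lies in `A` when it lies in an overgroup of `A` of index prime
to `q`. -/
lemma MulSwaps.mem_of_not_dvd {A K : Subgroup G} {g : G} (h : MulSwaps A (Subgroup.zpowers g))
    (hAK : A ≤ K) (hgK : g ∈ K) {q : ℕ} (hq : q.Prime) (hg : IsPrimaryElt q g)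
    (hqK : ¬ q ∣ A.relIndex K) : g ∈ A := by
  rw [← Subgroup.zpowers_le, ← Subgroup.relIndex_eq_one]
  have hB := Subgroup.zpowers_le.2 hgK
  -- `A⟨g⟩` is a subgroup of `K`, so `|⟨g⟩ : A ∩ ⟨g⟩| = |A⟨g⟩ : A|` divides `|K : A|`; it is also a
  -- power of `q`, hence trivial.
  have h1 : A.relIndex (Subgroup.zpowers g) ∣ A.relIndex K := by
    rw [← relIndex_eq_of_factor (M := A ⊔ Subgroup.zpowers g) le_sup_right
      fun m hm => h.exists_mul hm]
    exact relIndex_dvd_of_le_of_le le_sup_left (sup_le hAK hB)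
  refine eq_one_of_forall_prime_not_dvd fun r hr hrd => hqK ?_
  have := IsPGroup.eq_of_prime_dvd_card hq hr hg.isPGroup_zpowers
    (hrd.trans (Subgroup.relIndex_dvd_card _ _))
  exact this ▸ hrd.trans h1

/-- If `A` supplements `T`, which contains Sylow `q`-subgroups of the group, and `A` is
`X`-permutable with the cyclic subgroups of prime power order of `T`, then `A X` permutes with the
subgroup generated by any `q`-element. -/
lemma mulSwaps_sup_zpowers {A X T : Subgroup G} [X.Normal] {B : Subgroup G} (hBA : B ≤ A)
    (hBT : (B : Set G) * (T : Set G) = Set.univ)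
    (hperm : ∀ Z : Subgroup G, Z ≤ T → IsCyclic Z → IsPrimePow (Nat.card Z) →
      XPermutes (X : Set G) A Z)
    {q : ℕ} (hq : q.Prime) (hqT : ¬ q ∣ T.index) {g : G} (hg : IsPrimaryElt q g) :
    MulSwaps (A ⊔ X) (Subgroup.zpowers g) := by
  obtain ⟨Q, hQ⟩ := exists_isSylowIn hq T
  obtain ⟨k, -, hk⟩ := (hQ.trans hq le_top (by simpa using hqT)).exists_conj hq
    (le_top : Subgroup.zpowers g ≤ ⊤) hg.isPGroup_zpowers
  have hgk := mem_conj_smul.1 (hk (Subgroup.mem_zpowers g))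
  -- The factor `s` is absorbed by `T`, leaving a conjugator `b ∈ B ≤ A`.
  obtain ⟨b, hb, s, hs, rfl⟩ : k ∈ (B : Set G) * (T : Set G) := hBT ▸ Set.mem_univ k
  have hzT : b⁻¹ * g * b ∈ T := by
    have := mul_mem (mul_mem hs (hQ.le hgk)) (inv_mem hs)
    simpa [mul_assoc] using this
  set z := b⁻¹ * g * b with hz
  have hgz : Subgroup.zpowers g = MulAut.conj b • Subgroup.zpowers z := by
    rw [Subgroup.zpowers_eq_closure, Subgroup.zpowers_eq_closure, Subgroup.smul_closure,
      Set.smul_set_singleton, MulAut.smul_def, MulAut.conj_apply]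
    simp [hz, mul_assoc]
  have hzq : IsPrimaryElt q z := by simpa using hg.conj b⁻¹
  -- The trivial group is separated because `1` is not a prime power, so `hperm` does not cover it.
  rcases eq_or_ne z 1 with hz1 | hz1
  · rw [hgz, hz1]
    intro c hc a ha
    refine ⟨a, ha, 1, one_mem _, ?_⟩
    have hc1 : c = 1 := by simpa using hc
    simp [hc1]
  · have := Fact.mk hq
    obtain ⟨n, hn⟩ := IsPGroup.iff_card.1 hzq.isPGroup_zpowers
    have hn0 : n ≠ 0 := by
      rintro rfl
      rw [pow_zero, Subgroup.card_eq_one, Subgroup.zpowers_eq_bot] at hn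
      exact hz1 hn
    obtain ⟨x, hx, hxA⟩ := hperm _ (Subgroup.zpowers_le.2 hzT) inferInstance
      (hn ▸ hq.isPrimePow.pow hn0)
    have h1 := ((Permutes.mulSwaps hxA).sup_normal X).conj_smul
      (mul_mem (Subgroup.mem_sup_left (hBA hb)) (Subgroup.mem_sup_right hx) : b * x ∈ A ⊔ X)
    rwa [conj, ← conj_smul_mul, mul_inv_cancel_right, ← hgz] at h1

/-- If `p` does not divide `r j`, the next term contains all `p`-elements of the present one, hence
a Sylow `p`-subgroup. -/
lemma dvd_of_dvd_relIndex_primarySeries (X : Subgroup G) (r : ℕ → ℕ) (j : ℕ) {p : ℕ}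
    (hp : p.Prime) (hpπ : p ∈ π)
    (h : p ∣ (primarySeries π X r (j + 1)).relIndex (primarySeries π X r j)) : p ∣ r j := by
  by_contra hpr
  obtain ⟨P, hP⟩ := exists_isSylowIn hp (primarySeries π X r j)
  refine hP.not_dvd (h.trans (Subgroup.relIndex_dvd_of_le_left _ fun g hg => ?_))
  exact Subgroup.mem_sup_right
    (Subgroup.subset_closure ⟨hP.le hg, p, hpπ, hp, hpr, .of_mem hP.isPGroup hg⟩)

end Permutability

end PiHall

/-! ### Assembly of the series between `G` and `X`. -/

theorem theorem5p3 {G : Type*} [Group G] [Finite G] (π : Set ℕ) (hπ : ∀ p ∈ π, p.Prime)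
    (X : Subgroup G) (hXnormal : X.Normal) (hX : PiHall.IsEN π X)
    (t : ℕ) (ht : 1 ≤ t) (H : ℕ → Subgroup G)
    (hH0 : H 0 = ⊥) (hH01 : H 0 < H 1) (hHmono : ∀ i < t, H i ≤ H (i + 1)) (hHt : H t = ⊤)
    (hindex : ∀ i < t, PiHall.AtMostOnePrime π ((H i).relIndex (H (i + 1))))
    (T : Subgroup G) (hT : (H 1 : Set G) * (T : Set G) = Set.univ)
    (hTindex : PiHall.IsPiNumber πᶜ T.index)
    (hperm : ∀ i, 1 ≤ i → i ≤ t → ∀ Z : Subgroup G, Z ≤ T → IsCyclic Z →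
      IsPrimePow (Nat.card Z) → PiHall.XPermutes (X : Set G) (H i) Z) :
    PiHall.IsDS π G := by
  obtain ⟨S', hS', hSn'⟩ := hX
  have hS : PiHall.IsHallIn π (S'.map X.subtype) X := by
    rw [← PiHall.isHall_subgroupOf (Subgroup.map_subtype_le S'), Subgroup.subgroupOf,
      Subgroup.comap_map_eq_self_of_injective X.subtype_injective]
    exact hS'
  have hSn : PiHall.PrimaryCommute (S'.map X.subtype) :=
    (PiHall.isNilpotent_iff_primaryCommute.1 hSn').map X.subtype X.subtype_injective
  have hH1 : ∀ i, 1 ≤ i → i ≤ t → H 1 ≤ H i := by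
    intro i hi
    induction i, hi using Nat.le_induction with
    | base => exact fun _ => le_rfl
    | succ i _ ih => exact fun h => (ih (by omega)).trans (hHmono i (by omega))
  have hswap : ∀ i ≤ t, ∀ q ∈ π, ∀ g : G, PiHall.IsPrimaryElt q g →
      PiHall.MulSwaps (H i ⊔ X) (Subgroup.zpowers g) := by
    intro i hi q hqπ g hg
    -- `hperm` starts at `i = 1`, but the descent ends at `H 0 X = X`, where permutability follows
    -- from normality of `X`.
    rcases Nat.eq_zero_or_pos i with rfl | hi0
    · rw [hH0]
      refine PiHall.MulSwaps.sup_normal (fun b hb a ha => ?_) X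
      exact ⟨a, ha, b, hb, by rw [Subgroup.mem_bot.1 ha, mul_one, one_mul]⟩
    · exact PiHall.mulSwaps_sup_zpowers (hH1 i hi0 hi) hT (hperm i hi0 hi) (hπ q hqπ)
        (PiHall.isPiNumber_compl_iff.1 hTindex q (hπ q hqπ) hqπ) hg
  -- The indices are read from the top down; `t - (j + 1) + 1` is `t - j` for `j < t`, in the form
  -- that `hindex` takes.
  let r : ℕ → ℕ := fun j => (H (t - (j + 1))).relIndex (H (t - (j + 1) + 1))
  have hle : ∀ j ≤ t, PiHall.primarySeries π X r j ≤ H (t - j) ⊔ X := by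
    intro j
    induction j with
    | zero => exact fun _ => by simp [hHt]
    | succ j ih =>
      intro hj
      refine sup_le le_sup_right ((Subgroup.closure_le _).2 ?_)
      rintro g ⟨hg, q, hqπ, hq, hqr, hgq⟩
      have hg' := ih (by omega) hg
      rw [show t - j = t - (j + 1) + 1 by omega] at hg'
      exact (hswap _ (by omega) q hqπ g hgq).mem_of_not_dvd
        (sup_le_sup_right (hHmono _ (by omega)) X) hg' hq hgq
        fun h => hqr (h.trans (PiHall.relIndex_sup_dvd _ _ X))
  have hlast : PiHall.primarySeries π X r t = X := by
    refine le_antisymm ((hle t le_rfl).trans ?_) (PiHall.le_primarySeries X r t)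
    simp [hH0]
  refine (PiHall.hasDominantSolubleHall_of_series (t := t) (PiHall.primarySeries_normal X r) rfl
    (fun j _ => PiHall.primarySeries_succ_le X r j) (fun j hj p q hp hq hpπ hqπ hpd hqd => ?_)
    (by rwa [hlast]) hSn).isDS
  exact hindex (t - (j + 1)) (by omega) p q hp hq hpπ hqπ
    (PiHall.dvd_of_dvd_relIndex_primarySeries X r j hp hpπ hpd)
    (PiHall.dvd_of_dvd_relIndex_primarySeries X r j hq hqπ hqd)
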